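/- Let $F$ be an infinite field, $V$ a finite-dimensional $F$-vector space, and $\mathcal{A}$ an affine hyperplane arrangement in $V$, i.e. a finite set of affine hyperplanes of $V$. Let $L(\mathcal{A})$ be its intersection poset: the set of all nonempty intersections of hyperplanes of $\mathcal{A}$ (including the empty intersection $\hat 0 = V$), ordered by reverse inclusion, with $r(X) = \operatorname{codim} X$. An ideal of $L(\mathcal{A})$ is a nonempty down-closed subset, and $\langle X\rangle = \{Y \mid Y \le X\}$. The meet-complement of an ideal $\mathcal{I}$ is $\mathcal{I}^c = \{Y \in L(\mathcal{A}) \mid Y \wedge X = \hat 0 \text{ for all } X \in \mathcal{I}\}$. The ideal $\mathcal{I} =: \mathcal{I}_1$ is called modular if, with $\mathcal{I}_2 := \mathcal{I}^c$, (I1) for every $X \in L(\mathcal{A})\setminus\{\hat 0\}$ there are $j \in \{1,2\}$ and $Z \ne \hat 0$ with $\mathcal{I}_j \cap \langle X\rangle = \langle Z\rangle$; (I2) $X_1 \cap X_2 \neq \emptyset$ for all $X_1 \in \mathcal{I}_1$, $X_2 \in \mathcal{I}_2$; (I3) $r(X_1 \cap X_2) = r(X_1) + r(X_2)$ for all $X_1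 \in \mathcal{I}_1$, $X_2 \in \mathcal{I}_2$. Let $\mathcal{K}$ be a commutative ring. The Orlik–Solomon algebra $A(\mathcal{A})$ over $\mathcal{K}$ is the graded algebra $E/I$, where $E$ is the exterior algebra of the free $\mathcal{K}$-module with basis $\{e_H\}_{H\in\mathcal{A}}$, and $I$ is the ideal generated by the products $e_{H_1}\cdots e_{H_p}$ with $H_1\cap\dots\cap H_p = \emptyset$ and by the elements $\sum_{k=1}^p (-1)^{k-1} e_{H_1}\cdots\widehat{e_{H_k}}\cdots e_{H_p}$ for all tuples with $H_1\cap\dots\cap H_p \ne \emptyset$ and $\operatorname{codim}(H_1\cap\dots\cap H_p) < p$. Then for every modular ideal $\mathcal{I}$ of $L(\mathcal{A})$ there exist affine hyperplane arrangements $\mathcal{B}$ and $\mathcal{C}$ in finite-dimensional $F$-vector spaces such that $L(\mathcal{B}) \cong \mathcal{I}$ and $L(\mathcal{C}) \cong \mathcal{I}^c$ as posets and $$A(\mathcal{A}) \cong A(\mathcal{B}) \otimes_{\mathcal{K}} A(\mathcal{C})$$ as graded $\mathcal{K}$-modules. -/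

import Mathlib

open scoped TensorProduct

/-- The codimension of an affine subspace of `V`. -/
noncomputable def affineCodim {F V : Type*} [Field F] [AddCommGroup V] [Module F V]
    (X : AffineSubspace F V) : ℕ :=
  Module.finrank F (V ⧸ X.direction)

/-- A hyperplane arrangement: a finite set of affine hyperplanes of `V`, that is, of nonempty
affine subspaces of codimension one. -/
structure HyperplaneArrangement (F V : Type*) [Field F] [AddCommGroup V] [Module F V] where
  hyperplanes : Finset (AffineSubspace F V)
  ne_bot_of_mem : ∀ H ∈ hyperplanes, H ≠ ⊥
  codim_of_mem : ∀ H ∈ hyperplanes, affineCodim H = 1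

namespace HyperplaneArrangement

variable {F V : Type*} [Field F] [AddCommGroup V] [Module F V]

/-- The nonempty intersections of hyperplanes of `A`. The empty intersection is `V` itself.
They are kept in the order dual of `AffineSubspace F V`, so that they are ordered by reverse
inclusion. -/
def flats (A : HyperplaneArrangement F V) : Set (AffineSubspace F V)ᵒᵈ :=
  {X | OrderDual.ofDual X ≠ ⊥ ∧
    ∃ S : Set (AffineSubspace F V), S ⊆ A.hyperplanes ∧ OrderDual.ofDual X = sInf S}

/-- The intersection poset `L(A)`, ordered by reverse inclusion. -/
abbrev L (A : HyperplaneArrangement F V) : Type _ := A.flats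

/-- The element of the intersection poset, as an affine subspace of `V`. -/
def L.space {A : HyperplaneArrangement F V} (X : A.L) : AffineSubspace F V :=
  OrderDual.ofDual X.1

/-- The order of `L(A)` is reverse inclusion. -/
theorem L.le_iff {A : HyperplaneArrangement F V} (X Y : A.L) : X ≤ Y ↔ Y.space ≤ X.space :=
  Iff.rfl

/-- The least element of `L(A)` is `V`. -/
instance (A : HyperplaneArrangement F V) : OrderBot A.L where
  bot := ⟨OrderDual.toDual ⊤, (bot_ne_top (α := AffineSubspace F V)).symm, ∅,
    Set.empty_subset _, sInf_empty.symm⟩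
  bot_le X := (L.le_iff _ X).2 le_top

/-- The rank of an element of the intersection poset is its codimension. -/
noncomputable def L.rank {A : HyperplaneArrangement F V} (X : A.L) : ℕ := affineCodim X.space

/-- An ideal of `L(A)` is a (nonempty) down-closed subset. -/
def IsIdeal {A : HyperplaneArrangement F V} (I : Set A.L) : Prop := I.Nonempty ∧ IsLowerSet I

/-- Ideal decompositions of `L(A)`. The join of elements of `L(A)` is their intersection, and it
exists if and only if this intersection is nonempty. -/
structure IsIdealDecomposition {A : HyperplaneArrangement F V} {m : ℕ}
    (I : Fin m → Set A.L) : Prop where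
  isIdeal : ∀ j, IsIdeal (I j)
  meet_condition : ∀ X : A.L, X ≠ ⊥ → ∃ j, ∃ Z : A.L, Z ≠ ⊥ ∧ I j ∩ Set.Iic X = Set.Iic Z
  join_condition : ∀ X : Fin m → A.L, (∀ i, X i ∈ I i) → (⨅ i, (X i).space) ≠ ⊥
  rank_condition : ∀ X : Fin m → A.L, (∀ i, X i ∈ I i) →
    affineCodim (⨅ i, (X i).space) = ∑ i, (X i).rank

/-- The meet-complement of `I`: all `Y` whose meet with every `X ∈ I` is the least element. -/
def meetCompl {A : HyperplaneArrangement F V} (I : Set A.L) : Set A.L :=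
  {Y | ∀ X ∈ I, IsGLB {Y, X} ⊥}

/-- `I` is a modular ideal if `I` and its meet-complement form an ideal decomposition. -/
def IsModularIdeal {A : HyperplaneArrangement F V} (I : Set A.L) : Prop :=
  IsIdealDecomposition ![I, meetCompl I]

section OrlikSolomon

variable (K : Type*) [CommRing K] (A : HyperplaneArrangement F V)

/-- The exterior algebra of the free `K`-module on the hyperplanes of `A`. -/
abbrev E : Type _ := ExteriorAlgebra K (A.hyperplanes →₀ K)

/-- The basis element `e_H`. -/
noncomputable def eBasis (H : A.hyperplanes) : E K A :=
  ExteriorAlgebra.ι K (Finsupp.single H 1)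

/-- The product `e_S = e_{H₁} ⋯ e_{Hₚ}` of a tuple `S = (H₁, …, Hₚ)`. -/
noncomputable def eTuple {p : ℕ} (S : Fin p → A.hyperplanes) : E K A :=
  (List.ofFn fun i => eBasis K A (S i)).prod

/-- The boundary map of the exterior algebra: contraction with the linear form that takes every
`e_H` to `1`. -/
noncomputable def boundary : E K A →ₗ[K] E K A :=
  CliffordAlgebra.contractLeft (Finsupp.linearCombination K fun _ => (1 : K))

theorem boundary_one : boundary K A 1 = 0 := CliffordAlgebra.contractLeft_one _ _

/-- The boundary of a product is the alternating sum of the products with one factor removed. -/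
theorem boundary_eTuple {p : ℕ} (S : Fin (p + 1) → A.hyperplanes) :
    boundary K A (eTuple K A S) =
      ∑ k : Fin (p + 1), (-1 : K) ^ (k : ℕ) • eTuple K A (fun i => S (k.succAbove i)) := by
  have key : ∀ {p : ℕ} (S : Fin (p + 1) → A.hyperplanes),
      boundary K A (eTuple K A S) = eTuple K A (fun i => S i.succ)
        - eBasis K A (S 0) * boundary K A (eTuple K A fun i => S i.succ) := by
    intro p S
    rw [eTuple, List.ofFn_succ, List.prod_cons, boundary, eBasis]
    erw [CliffordAlgebra.contractLeft_ι_mul]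
    simp [eTuple, eBasis]
  induction p with
  | zero =>
    rw [key]
    simp [eTuple, boundary_one]
  | succ p ih =>
    rw [key, ih, Finset.mul_sum, sub_eq_add_neg, ← Finset.sum_neg_distrib,
      Fin.sum_univ_succ (n := p + 1)]
    congr 1
    · simp
    · refine Finset.sum_congr rfl fun k _ => ?_
      have : eTuple K A (fun i => S (k.succ.succAbove i)) =
          eBasis K A (S 0) * eTuple K A (fun i => S ((k.succAbove i).succ)) := by
        rw [eTuple, List.ofFn_succ, List.prod_cons]
        simp [eTuple]
      rw [this]
      simp [pow_succ]

/-- The intersection of a tuple of hyperplanes (which is `V` for the empty tuple). -/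
def interTuple {p : ℕ} (S : Fin p → A.hyperplanes) : AffineSubspace F V :=
  ⨅ i, (S i : AffineSubspace F V)

/-- A tuple is dependent if its intersection is nonempty, of codimension less than its length. -/
def IsDependent {p : ℕ} (S : Fin p → A.hyperplanes) : Prop :=
  A.interTuple S ≠ ⊥ ∧ affineCodim (A.interTuple S) < p

/-- The ideal of the exterior algebra generated by the `e_S` with `⋂ S = ∅` and the `∂ e_S` with
`S` dependent. -/
noncomputable def osIdeal : TwoSidedIdeal (E K A) :=
  TwoSidedIdeal.span
    ({x | ∃ (p : ℕ) (S : Fin p → A.hyperplanes), A.interTuple S = ⊥ ∧ x = eTuple K A S} ∪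
     {x | ∃ (p : ℕ) (S : Fin p → A.hyperplanes), A.IsDependent S ∧ x = boundary K A (eTuple K A S)})

/-- The Orlik–Solomon algebra of `A` with coefficients in `K`. -/
abbrev OrlikSolomon : Type _ := (osIdeal K A).ringCon.Quotient

/-- The projection of the exterior algebra onto the Orlik–Solomon algebra, as a linear map. -/
noncomputable def osProj : E K A →ₗ[K] OrlikSolomon K A where
  toFun x := (x : (osIdeal K A).ringCon.Quotient)
  map_add' _ _ := rfl
  map_smul' _ _ := rfl

/-- The component of degree `p` of the Orlik–Solomon algebra: the image of the component of
degree `p` of the exterior algebra. -/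
noncomputable def osDegree (p : ℕ) : Submodule K (OrlikSolomon K A) :=
  (⋀[K]^p (A.hyperplanes →₀ K)).map (osProj K A)

end OrlikSolomon

/-- The component of degree `n` of the tensor product of the Orlik–Solomon algebras of `B` and `C`:
the sum over `p + q = n` of the images of `A_p(B) ⊗ A_q(C)`. -/
noncomputable def osTensorDegree {W W' : Type*} [AddCommGroup W] [Module F W]
    [AddCommGroup W'] [Module F W'] (K : Type*) [CommRing K]
    (B : HyperplaneArrangement F W) (C : HyperplaneArrangement F W') (n : ℕ) :
    Submodule K (OrlikSolomon K B ⊗[K] OrlikSolomon K C) :=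
  ⨆ (p : ℕ) (q : ℕ) (_ : p + q = n),
    LinearMap.range (TensorProduct.map (osDegree K B p).subtype (osDegree K C q).subtype)

end HyperplaneArrangement

/-!
Each of the two ideals is realized on a slice: a generic translate of a maximal flat of the other
ideal is transversal to the flats of the ideal and, `F` being infinite, misses every other
intersection of its hyperplanes.

The algebra of a realization embeds in that of `A` as the span of the monomials whose intersection
lies in the ideal, so the isomorphism is given by multiplication in the Orlik–Solomon algebra. Both
halves of its bijectivity rest on the identity `e_H * ∂ x = x`, valid for a monomial `x` whose
intersection is nonempty and contained in `H`. By (I1) the hyperplane `H` can be chosen to contain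
the largest flat of one of the ideals below the given one. For surjectivity, `∂` shortens the
monomial and multiplication by `e_H` enlarges only the factor of that ideal. For injectivity, which
by the grading of the algebra by flats can be tested on one flat at a time, `∂` moves a relation to
flats lower in the poset, and by (I2) and (I3) its two Leibniz terms are supported on different
flats, hence vanish separately.
-/

section AffineCodim

variable {F V : Type*} [Field F] [AddCommGroup V] [Module F V]

theorem inf_ne_bot_of_direction_sup_eq_top {X Y : AffineSubspace F V} (hX : X ≠ ⊥) (hY : Y ≠ ⊥)
    (h : X.direction ⊔ Y.direction = ⊤) : X ⊓ Y ≠ ⊥ := by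
  rw [← AffineSubspace.nonempty_iff_ne_bot] at hX hY ⊢
  exact AffineSubspace.inter_nonempty_of_nonempty_of_sup_direction_eq_top hX hY h

@[simp]
theorem affineCodim_top : affineCodim (⊤ : AffineSubspace F V) = 0 := by
  rw [affineCodim, AffineSubspace.direction_top]
  exact Module.finrank_zero_of_subsingleton

variable [FiniteDimensional F V]

theorem affineCodim_add_finrank (X : AffineSubspace F V) :
    affineCodim X + Module.finrank F X.direction = Module.finrank F V :=
  Submodule.finrank_quotient_add_finrank _

theorem eq_of_le_of_affineCodim_le {X Y : AffineSubspace F V} (hX : X ≠ ⊥) (h : X ≤ Y)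
    (hc : affineCodim X ≤ affineCodim Y) : X = Y := by
  refine AffineSubspace.eq_of_direction_eq_of_nonempty_of_le ?_
    ((AffineSubspace.nonempty_iff_ne_bot X).2 hX) h
  refine Submodule.eq_of_le_of_finrank_le (AffineSubspace.direction_le h) ?_
  have hcX := affineCodim_add_finrank X
  have hcY := affineCodim_add_finrank Y
  omega

theorem affineCodim_lt_of_lt {X Y : AffineSubspace F V} (hX : X ≠ ⊥) (h : X < Y) :
    affineCodim Y < affineCodim X :=
  not_le.1 fun hc => h.ne (eq_of_le_of_affineCodim_le hX h.le hc)

theorem affineCodim_inf_add_finrank_sup {X Y : AffineSubspace F V} (h : X ⊓ Y ≠ ⊥) :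
    affineCodim (X ⊓ Y) + Module.finrank F V =
      affineCodim X + affineCodim Y + Module.finrank F ↥(X.direction ⊔ Y.direction) := by
  obtain ⟨p, hp⟩ := (AffineSubspace.nonempty_iff_ne_bot _).2 h
  have hinf := affineCodim_add_finrank (X ⊓ Y)
  have hX := affineCodim_add_finrank X
  have hY := affineCodim_add_finrank Y
  have hsup := Submodule.finrank_sup_add_finrank_inf_eq X.direction Y.direction
  rw [AffineSubspace.direction_inf_of_mem_inf hp] at hinf
  omega

theorem affineCodim_inf_le {X Y : AffineSubspace F V} (h : X ⊓ Y ≠ ⊥) :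
    affineCodim (X ⊓ Y) ≤ affineCodim X + affineCodim Y := by
  have hsum := affineCodim_inf_add_finrank_sup h
  have hsup := Submodule.finrank_le (X.direction ⊔ Y.direction)
  omega

theorem direction_sup_eq_top_iff {X Y : AffineSubspace F V} (h : X ⊓ Y ≠ ⊥) :
    X.direction ⊔ Y.direction = ⊤ ↔ affineCodim (X ⊓ Y) = affineCodim X + affineCodim Y := by
  have hsum := affineCodim_inf_add_finrank_sup h
  refine ⟨fun htop => ?_, fun hcodim => Submodule.eq_top_of_finrank_eq (by omega)⟩
  rw [htop, finrank_top] at hsum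
  omega

end AffineCodim

section AffineComap

variable {F V W : Type*} [Field F] [AddCommGroup V] [Module F V] [AddCommGroup W] [Module F W]

theorem direction_comap_of_ne_bot {X : AffineSubspace F V} {f : W →ᵃ[F] V}
    (h : X.comap f ≠ ⊥) : (X.comap f).direction = X.direction.comap f.linear := by
  obtain ⟨p, hp⟩ := (AffineSubspace.nonempty_iff_ne_bot _).2 h
  ext w
  rw [← AffineSubspace.vadd_mem_iff_mem_direction w hp, Submodule.mem_comap,
    ← AffineSubspace.vadd_mem_iff_mem_direction _ (AffineSubspace.mem_comap.1 hp),
    AffineSubspace.mem_comap, AffineMap.map_vadd]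

theorem comap_ne_bot_of_direction_sup_range_eq_top {X : AffineSubspace F V} {f : W →ᵃ[F] V}
    (hX : X ≠ ⊥) (h : X.direction ⊔ LinearMap.range f.linear = ⊤) : X.comap f ≠ ⊥ := by
  have hne : X ⊓ (⊤ : AffineSubspace F W).map f ≠ ⊥ := by
    refine inf_ne_bot_of_direction_sup_eq_top hX (by simp) ?_
    rwa [AffineSubspace.map_direction, AffineSubspace.direction_top, Submodule.map_top]
  obtain ⟨_, hx, w, -, rfl⟩ := (AffineSubspace.nonempty_iff_ne_bot _).2 hne
  exact (AffineSubspace.nonempty_iff_ne_bot _).1 ⟨w, hx⟩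

theorem affineCodim_comap {X : AffineSubspace F V} {f : W →ᵃ[F] V}
    (hX : X ≠ ⊥) (h : X.direction ⊔ LinearMap.range f.linear = ⊤) :
    affineCodim (X.comap f) = affineCodim X := by
  have hsurj : Function.Surjective (X.direction.mkQ ∘ₗ f.linear) := by
    rw [← LinearMap.range_eq_top, LinearMap.range_comp, Submodule.map_mkQ_eq_top, h]
  have hker : LinearMap.ker (X.direction.mkQ ∘ₗ f.linear) = (X.comap f).direction := by
    rw [LinearMap.ker_comp, Submodule.ker_mkQ,
      direction_comap_of_ne_bot (comap_ne_bot_of_direction_sup_range_eq_top hX h)]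
  rw [affineCodim, affineCodim, ← hker]
  exact (LinearMap.quotKerEquivOfSurjective _ hsurj).finrank_eq

theorem exists_affineMap_range_linear_eq [FiniteDimensional F V] (D : Submodule F V) (v : V) :
    ∃ (m : ℕ) (f : (Fin m → F) →ᵃ[F] V), LinearMap.range f.linear = D ∧ ∀ w, f w - v ∈ D := by
  let φ : (Fin (Module.finrank F D) → F) →ₗ[F] V :=
    D.subtype ∘ₗ (Module.finBasis F D).equivFun.symm.toLinearMap
  have hφ : LinearMap.range φ = D := by
    rw [LinearMap.range_comp, LinearEquiv.range, Submodule.map_top, Submodule.range_subtype]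
  refine ⟨_, φ.toAffineMap + AffineMap.const F _ v, ?_, fun w => ?_⟩
  · rw [AffineMap.add_linear, AffineMap.const_linear, add_zero]
    exact hφ
  · simpa [hφ] using LinearMap.mem_range_self φ w

end AffineComap

section Genericity

variable {F V : Type*} [Field F] [Infinite F] [AddCommGroup V] [Module F V]

theorem eq_top_of_finiteIndex_toAddSubgroup (p : Submodule F V)
    (h : p.toAddSubgroup.FiniteIndex) : p = ⊤ := by
  by_contra hp
  have : Finite (V ⧸ p) := AddSubgroup.finite_quotient_of_finiteIndex
  have : Nontrivial (V ⧸ p) := Submodule.Quotient.nontrivial_iff.2 hp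
  have : Infinite (V ⧸ p) := Module.Free.infinite F (V ⧸ p)
  exact not_finite (V ⧸ p)

open scoped Pointwise in
theorem exists_forall_notMem_of_ne_top {S : Set (AffineSubspace F V)} (hS : S.Finite)
    (hne : ∀ X ∈ S, X ≠ ⊤) : ∃ v, ∀ X ∈ S, v ∉ X := by
  by_contra! hcover
  let T := (hS.sep fun X => (X : Set V).Nonempty).toFinset
  have hcov : ⋃ X ∈ T, Classical.epsilon (· ∈ X) +ᵥ (X.direction.toAddSubgroup : Set V) =
      Set.univ := by
    refine Set.eq_univ_of_forall fun v => ?_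
    obtain ⟨X, hXS, hv⟩ := hcover v
    refine Set.mem_biUnion (Set.Finite.mem_toFinset _ |>.2 ⟨hXS, v, hv⟩)
      ⟨v - Classical.epsilon (· ∈ X), ?_, by simp⟩
    exact AffineSubspace.vsub_mem_direction hv (Classical.epsilon_spec ⟨v, hv⟩)
  obtain ⟨X, hX, hfin⟩ := AddSubgroup.exists_finiteIndex_of_leftCoset_cover hcov
  obtain ⟨hXS, hXne⟩ := (Set.Finite.mem_toFinset _).1 hX
  exact hne X hXS ((AffineSubspace.direction_eq_top_iff_of_nonempty hXne).1
    (eq_top_of_finiteIndex_toAddSubgroup _ hfin))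

theorem exists_forall_sub_notMem_of_sup_ne_top {S : Set (AffineSubspace F V)} (hS : S.Finite)
    (D : Submodule F V) :
    ∃ v, ∀ X ∈ S, X.direction ⊔ D ≠ ⊤ → ∀ x ∈ X, x - v ∉ D := by
  let π := D.mkQ.toAffineMap
  obtain ⟨w, hw⟩ := exists_forall_notMem_of_ne_top
    ((hS.sep fun X => X.direction ⊔ D ≠ ⊤).image (AffineSubspace.map π)) (by
      rintro _ ⟨X, ⟨-, hX⟩, rfl⟩ htop
      refine hX ?_
      have hdir : X.direction.map D.mkQ = ⊤ := by
        rw [← AffineSubspace.direction_top F (V ⧸ D) (V ⧸ D), ← htop]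
        exact (AffineSubspace.map_direction π X).symm
      rwa [Submodule.map_mkQ_eq_top, sup_comm] at hdir)
  obtain ⟨v, rfl⟩ := D.mkQ_surjective w
  refine ⟨v, fun X hX htop x hx hxv => hw _ ⟨X, ⟨hX, htop⟩, rfl⟩ ?_⟩
  exact ⟨x, hx, (Submodule.Quotient.eq D).2 hxv⟩

end Genericity

namespace HyperplaneArrangement

variable {F V : Type*} [Field F] [AddCommGroup V] [Module F V] (A : HyperplaneArrangement F V)

section Inter

/-- The intersection of a list of hyperplanes. Lists, unlike the tuples `Fin p → A.hyperplanes`,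
can be concatenated. -/
def inter (l : List A.hyperplanes) : AffineSubspace F V :=
  ⨅ H ∈ l, (H : AffineSubspace F V)

@[simp]
theorem inter_nil : A.inter [] = ⊤ := by simp [inter]

@[simp]
theorem inter_cons (H : A.hyperplanes) (l : List A.hyperplanes) :
    A.inter (H :: l) = (H : AffineSubspace F V) ⊓ A.inter l := by
  simp [inter, iInf_or, iInf_inf_eq]

@[simp]
theorem inter_append (l l' : List A.hyperplanes) :
    A.inter (l ++ l') = A.inter l ⊓ A.inter l' := by
  simp [inter, iInf_or, iInf_inf_eq]

theorem le_inter_iff {l : List A.hyperplanes} {X : AffineSubspace F V} :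
    X ≤ A.inter l ↔ ∀ H ∈ l, X ≤ (H : AffineSubspace F V) :=
  le_iInf₂_iff

theorem inter_le_of_mem {l : List A.hyperplanes} {H : A.hyperplanes} (h : H ∈ l) :
    A.inter l ≤ H :=
  iInf₂_le H h

theorem inter_anti {l l' : List A.hyperplanes} (h : l ⊆ l') : A.inter l' ≤ A.inter l :=
  biInf_mono fun _ hH => h hH

theorem inter_le_inter_eraseIdx (l : List A.hyperplanes) (k : ℕ) :
    A.inter l ≤ A.inter (l.eraseIdx k) :=
  A.inter_anti (List.eraseIdx_subset ..)

theorem interTuple_eq_inter {p : ℕ} (S : Fin p → A.hyperplanes) :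
    A.interTuple S = A.inter (List.ofFn S) := by
  simp [interTuple, inter, List.mem_ofFn, iInf_exists, iInf_comm (ι' := Fin p)]

theorem finite_range_inter : (Set.range A.inter).Finite := by
  refine (Set.finite_range fun S : Set A.hyperplanes => ⨅ H ∈ S, H.1).subset ?_
  rintro _ ⟨l, rfl⟩
  exact ⟨{H | H ∈ l}, rfl⟩

theorem mem_flats_iff (X : AffineSubspace F V) :
    OrderDual.toDual X ∈ A.flats ↔ X ≠ ⊥ ∧ ∃ l, X = A.inter l := by
  refine and_congr_right fun _ => ⟨?_, ?_⟩
  · rintro ⟨S, hS, hX⟩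
    have hfin : {H : A.hyperplanes | H.1 ∈ S}.Finite := Set.toFinite _
    refine ⟨hfin.toFinset.toList, Eq.trans hX (le_antisymm ?_ ?_)⟩
    · exact A.le_inter_iff.2 fun H hH => sInf_le (by simpa using hH)
    · exact le_sInf fun H hH => A.inter_le_of_mem (H := ⟨H, hS hH⟩) (by simpa using hH)
  · rintro ⟨l, rfl⟩
    refine ⟨Subtype.val '' {H | H ∈ l}, Subtype.coe_image_subset _ _, ?_⟩
    exact sInf_image.symm

theorem hyperplane_ne_top (H : A.hyperplanes) : (H : AffineSubspace F V) ≠ ⊤ := by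
  intro h
  simpa [h] using A.codim_of_mem _ H.2

@[simp]
theorem inter_eq_top_iff {l : List A.hyperplanes} : A.inter l = ⊤ ↔ l = [] := by
  cases l <;> simp [A.hyperplane_ne_top]

end Inter

section Dependent

variable {A}

variable (A) in
/-- A list of hyperplanes is dependent if its intersection is nonempty, of codimension less than
its length. This is `IsDependent` for lists in place of tuples. -/
def Dependent (l : List A.hyperplanes) : Prop :=
  A.inter l ≠ ⊥ ∧ affineCodim (A.inter l) < l.length

theorem isDependent_iff_dependent_ofFn {p : ℕ} (S : Fin p → A.hyperplanes) :
    A.IsDependent S ↔ A.Dependent (List.ofFn S) := by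
  rw [IsDependent, Dependent, interTuple_eq_inter, List.length_ofFn]

theorem Dependent.ne_nil {l : List A.hyperplanes} (h : A.Dependent l) : l ≠ [] := by
  rintro rfl
  simpa using h.2

variable [FiniteDimensional F V]

theorem affineCodim_inter_le {l : List A.hyperplanes} (h : A.inter l ≠ ⊥) :
    affineCodim (A.inter l) ≤ l.length := by
  induction l with
  | nil => simp
  | cons H l ih =>
    rw [inter_cons] at h
    have hinf := affineCodim_inf_le h
    rw [A.codim_of_mem _ H.2] at hinf
    have hl := ih (ne_bot_of_le_ne_bot h inf_le_right)
    rw [inter_cons, List.length_cons]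
    omega

theorem Dependent.append_append {l : List A.hyperplanes} (h : A.Dependent l)
    (t t' : List A.hyperplanes) (hne : A.inter (t ++ l ++ t') ≠ ⊥) :
    A.Dependent (t ++ l ++ t') := by
  refine ⟨hne, ?_⟩
  rw [inter_append, inter_append] at hne ⊢
  have hne_left : A.inter t ⊓ A.inter l ≠ ⊥ := ne_bot_of_le_ne_bot hne inf_le_left
  have hinf := affineCodim_inf_le hne
  have hinf_left := affineCodim_inf_le hne_left
  have ht := affineCodim_inter_le (ne_bot_of_le_ne_bot hne_left inf_le_left)
  have ht' := affineCodim_inter_le (ne_bot_of_le_ne_bot hne inf_le_right)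
  have hl := h.2
  simp only [List.length_append]
  omega

theorem Dependent.eraseIdx {l : List A.hyperplanes} (h : A.Dependent l) {k : ℕ}
    (hk : k < l.length) :
    A.Dependent (l.eraseIdx k) ∨ A.inter (l.eraseIdx k) = A.inter l := by
  have hle := A.inter_le_inter_eraseIdx l k
  refine or_iff_not_imp_left.2 fun hindep => (eq_of_le_of_affineCodim_le h.1 hle ?_).symm
  have hcodim := not_lt.1 fun hlt => hindep ⟨ne_bot_of_le_ne_bot h.1 hle, hlt⟩
  rw [List.length_eraseIdx_of_lt hk] at hcodim
  have := h.2
  omega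

theorem dependent_cons {l : List A.hyperplanes} {H : A.hyperplanes} (hne : A.inter l ≠ ⊥)
    (hH : A.inter l ≤ H) : A.Dependent (H :: l) := by
  have hinter : A.inter (H :: l) = A.inter l := by rw [inter_cons, inf_eq_right.2 hH]
  refine ⟨hinter ▸ hne, ?_⟩
  rw [hinter, List.length_cons]
  exact Nat.lt_succ_of_le (affineCodim_inter_le hne)

end Dependent

end HyperplaneArrangement

section ExteriorMonomials

variable (K : Type*) [CommRing K] {σ τ : Type*}

/-- The product of the basis vectors `e_i` of `σ →₀ K`, for `i` in the list `l`, in the exterior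
algebra of `σ →₀ K`. -/
noncomputable def extMonomial (l : List σ) : ExteriorAlgebra K (σ →₀ K) :=
  (l.map fun i => ExteriorAlgebra.ι K (Finsupp.single i 1)).prod

@[simp]
theorem extMonomial_nil : extMonomial K ([] : List σ) = 1 := rfl

theorem extMonomial_cons (i : σ) (l : List σ) :
    extMonomial K (i :: l) = ExteriorAlgebra.ι K (Finsupp.single i 1) * extMonomial K l := by
  simp [extMonomial]

theorem extMonomial_singleton (i : σ) :
    extMonomial K [i] = ExteriorAlgebra.ι K (Finsupp.single i 1) := by
  simp [extMonomial]

theorem extMonomial_append (l l' : List σ) :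
    extMonomial K (l ++ l') = extMonomial K l * extMonomial K l' := by
  simp [extMonomial]

theorem ι_mul_extMonomial (m : σ →₀ K) (l : List σ) :
    ExteriorAlgebra.ι K m * extMonomial K l =
      (-1 : K) ^ l.length • (extMonomial K l * ExteriorAlgebra.ι K m) := by
  induction l with
  | nil => simp
  | cons i l ih =>
    rw [extMonomial_cons, ← mul_assoc,
      eq_neg_of_add_eq_zero_left (ExteriorAlgebra.ι_add_mul_swap m _), neg_mul, mul_assoc, ih,
      List.length_cons, pow_succ]
    simp [mul_assoc]

theorem extMonomial_mul_comm (l l' : List σ) :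
    extMonomial K l * extMonomial K l' =
      (-1 : K) ^ (l.length * l'.length) • (extMonomial K l' * extMonomial K l) := by
  induction l with
  | nil => simp
  | cons i l ih =>
    rw [extMonomial_cons, mul_assoc, ih, mul_smul_comm, ← mul_assoc, ι_mul_extMonomial,
      smul_mul_assoc, smul_smul, ← pow_add, mul_assoc, List.length_cons, add_one_mul]

theorem exteriorPower_eq_span_extMonomial (p : ℕ) :
    ⋀[K]^p (σ →₀ K) = Submodule.span K (extMonomial K '' {l : List σ | l.length = p}) := by
  have hspan : Submodule.span K (Set.range fun i : σ => Finsupp.single i (1 : K)) = ⊤ := by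
    simpa using (Finsupp.basisSingleOne (R := K) (ι := σ)).span_eq
  rw [← exteriorPower.ιMulti_span_fixedDegree_of_span_eq_top K p _ hspan]
  congr 1
  ext x
  constructor
  · rintro ⟨m, hm, rfl⟩
    choose i hi using fun k => hm (Set.mem_range_self k)
    refine ⟨List.ofFn i, List.length_ofFn, ?_⟩
    rw [ExteriorAlgebra.ιMulti_apply, extMonomial, List.map_ofFn]
    simp only [← hi, Function.comp_def]
  · rintro ⟨l, rfl, rfl⟩
    refine ⟨fun k => Finsupp.single (l.get k) 1, by rintro _ ⟨k, rfl⟩; exact ⟨l.get k, rfl⟩, ?_⟩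
    conv_rhs => rw [extMonomial, ← List.ofFn_get l, List.map_ofFn]
    exact ExteriorAlgebra.ιMulti_apply _

theorem span_range_extMonomial :
    Submodule.span K (Set.range (extMonomial K : List σ → _)) = ⊤ := by
  rw [eq_top_iff, ← (DirectSum.Decomposition.isInternal
    fun p => ⋀[K]^p (σ →₀ K)).submodule_iSup_eq_top]
  refine iSup_le fun p => ?_
  rw [exteriorPower_eq_span_extMonomial]
  exact Submodule.span_mono (Set.image_subset_range _ _)

variable {K} in
theorem linearMap_ext_extMonomial {N : Type*} [AddCommMonoid N] [Module K N]
    {f g : ExteriorAlgebra K (σ →₀ K) →ₗ[K] N}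
    (h : ∀ l, f (extMonomial K l) = g (extMonomial K l)) : f = g :=
  LinearMap.ext_on (span_range_extMonomial K) (Set.forall_mem_range.2 h)

/-- The map of exterior algebras that relabels the basis vectors along `β`. -/
noncomputable def extMap (β : σ → τ) :
    ExteriorAlgebra K (σ →₀ K) →ₐ[K] ExteriorAlgebra K (τ →₀ K) :=
  ExteriorAlgebra.map (Finsupp.lmapDomain K K β)

@[simp]
theorem extMap_extMonomial (β : σ → τ) (l : List σ) :
    extMap K β (extMonomial K l) = extMonomial K (l.map β) := by
  simp [extMap, extMonomial, map_list_prod, Function.comp_def, Finsupp.mapDomain_single]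

/-- The map of exterior algebras that restricts to the basis vectors in the image of `β` and kills
the other ones. -/
noncomputable def extRestrict (β : σ ↪ τ) :
    ExteriorAlgebra K (τ →₀ K) →ₐ[K] ExteriorAlgebra K (σ →₀ K) :=
  ExteriorAlgebra.map (Finsupp.lcomapDomain β β.injective)

@[simp]
theorem extRestrict_extMonomial_map (β : σ ↪ τ) (l : List σ) :
    extRestrict K β (extMonomial K (l.map β)) = extMonomial K l := by
  simp [extRestrict, extMonomial, map_list_prod, Function.comp_def, Finsupp.lcomapDomain]

theorem extRestrict_extMonomial_of_notMem (β : σ ↪ τ) {l : List τ}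
    (hl : l ∉ Set.range (List.map β)) : extRestrict K β (extMonomial K l) = 0 := by
  obtain ⟨i, hi, hiβ⟩ : ∃ i ∈ l, i ∉ Set.range β := by simpa [Set.range_list_map] using hl
  rw [extMonomial, map_list_prod]
  refine List.prod_eq_zero (List.mem_map.2 ⟨_, List.mem_map.2 ⟨i, hi, rfl⟩, ?_⟩)
  rw [extRestrict, ExteriorAlgebra.map_apply_ι]
  exact (congrArg _ (Finsupp.comapDomain_single_of_not_mem_range hiβ 1 _)).trans (map_zero _)

end ExteriorMonomials

section Multigrading

variable {K : Type*} [CommRing K]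

theorem linearCombination_mul_linearCombination_neg {ι R : Type*} [Ring R] [Algebra K R]
    {x : ι → R} (hx : ∀ i j, x i * x j = -(x j * x i)) (m n : ι →₀ K) :
    Finsupp.linearCombination K x m * Finsupp.linearCombination K x n =
      -(Finsupp.linearCombination K x n * Finsupp.linearCombination K x m) := by
  induction m using Finsupp.induction_linear with
  | zero => simp
  | add a b ha hb => rw [map_add, add_mul, mul_add, ha, hb, neg_add]
  | single i c =>
    induction n using Finsupp.induction_linear with
    | zero => simp
    | add a b ha hb => rw [map_add, add_mul, mul_add, ha, hb, neg_add]
    | single j d =>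
      simp only [Finsupp.linearCombination_single, smul_mul_smul_comm, hx i j, smul_neg,
        mul_comm c d]

theorem linearCombination_mul_self_eq_zero {ι R : Type*} [Ring R] [Algebra K R] {x : ι → R}
    (hsq : ∀ i, x i * x i = 0) (hx : ∀ i j, x i * x j = -(x j * x i)) (m : ι →₀ K) :
    Finsupp.linearCombination K x m * Finsupp.linearCombination K x m = 0 := by
  induction m using Finsupp.induction_linear with
  | zero => simp
  | add a b ha hb =>
    rw [map_add, add_mul, mul_add, mul_add, ha, hb,
      linearCombination_mul_linearCombination_neg hx a b]
    simp
  | single i c => simp [hsq]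

variable (K) {σ : Type*}

/-- The multigrading of the exterior algebra of `σ →₀ K` by multisets of indices, encoded as a
coaction: every monomial is multiplied by the multiset of its factors. -/
noncomputable def extMultigrading :
    ExteriorAlgebra K (σ →₀ K) →ₐ[K]
      AddMonoidAlgebra (ExteriorAlgebra K (σ →₀ K)) (Multiset σ) :=
  ExteriorAlgebra.lift K ⟨Finsupp.linearCombination K fun i =>
      AddMonoidAlgebra.single {i} (ExteriorAlgebra.ι K (Finsupp.single i 1)),
    linearCombination_mul_self_eq_zero
      (fun i => by
        rw [AddMonoidAlgebra.single_mul_single, ExteriorAlgebra.ι_sq_zero,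
          AddMonoidAlgebra.single_zero])
      (fun i j => by
        rw [AddMonoidAlgebra.single_mul_single, AddMonoidAlgebra.single_mul_single,
          eq_neg_of_add_eq_zero_left (ExteriorAlgebra.ι_add_mul_swap _ _),
          AddMonoidAlgebra.single_neg, add_comm])⟩

theorem extMultigrading_extMonomial (l : List σ) :
    extMultigrading K (extMonomial K l) = AddMonoidAlgebra.single (l : Multiset σ)
      (extMonomial K l) := by
  induction l with
  | nil => exact map_one _
  | cons i l ih =>
    rw [extMonomial_cons, map_mul, ih, extMultigrading, ExteriorAlgebra.lift_ι_apply,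
      Finsupp.linearCombination_single, one_smul, AddMonoidAlgebra.single_mul_single,
      Multiset.singleton_add, Multiset.cons_coe]

open Classical in
/-- The projection of the exterior algebra of `σ →₀ K` onto the span of the monomials whose
multiset of factors satisfies `P`. -/
noncomputable def extProj (P : Multiset σ → Prop) :
    ExteriorAlgebra K (σ →₀ K) →ₗ[K] ExteriorAlgebra K (σ →₀ K) :=
  Finsupp.lsum K (fun s => if P s then LinearMap.id else 0) ∘ₗ
    (AddMonoidAlgebra.coeffLinearEquiv K).toLinearMap ∘ₗ (extMultigrading K).toLinearMap

open Classical in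
@[simp]
theorem extProj_extMonomial (P : Multiset σ → Prop) (l : List σ) :
    extProj K P (extMonomial K l) = if P l then extMonomial K l else 0 := by
  split_ifs with hP <;> simp [extProj, extMultigrading_extMonomial, hP]

end Multigrading

namespace HyperplaneArrangement

variable {F V : Type*} [Field F] [AddCommGroup V] [Module F V] {K : Type*} [CommRing K]
  {A : HyperplaneArrangement F V}

section Boundary

theorem eTuple_eq_extMonomial {p : ℕ} (S : Fin p → A.hyperplanes) :
    eTuple K A S = extMonomial K (List.ofFn S) := by
  simp [eTuple, eBasis, extMonomial, List.map_ofFn, Function.comp_def]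

theorem boundary_extMonomial_cons_mul (H : A.hyperplanes) (l : List A.hyperplanes) (x : E K A) :
    boundary K A (extMonomial K (H :: l) * x) =
      extMonomial K l * x - extMonomial K [H] * boundary K A (extMonomial K l * x) := by
  rw [extMonomial_cons, mul_assoc, extMonomial_singleton]
  refine (CliffordAlgebra.contractLeft_ι_mul _ _ _).trans ?_
  simp [boundary]

theorem boundary_extMonomial_cons (H : A.hyperplanes) (l : List A.hyperplanes) :
    boundary K A (extMonomial K (H :: l)) =
      extMonomial K l - extMonomial K [H] * boundary K A (extMonomial K l) := by
  simpa using boundary_extMonomial_cons_mul H l 1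

theorem boundary_extMonomial_mul (l : List A.hyperplanes) (x : E K A) :
    boundary K A (extMonomial K l * x) = boundary K A (extMonomial K l) * x +
      (-1 : K) ^ l.length • (extMonomial K l * boundary K A x) := by
  induction l with
  | nil => simp [boundary_one]
  | cons H l ih =>
    rw [boundary_extMonomial_cons_mul, boundary_extMonomial_cons, ih, extMonomial_cons K H l,
      extMonomial_singleton, List.length_cons, pow_succ]
    simp only [mul_add, sub_mul, mul_assoc, mul_smul_comm, mul_neg, mul_one, neg_smul]
    abel

theorem boundary_boundary (x : E K A) : boundary K A (boundary K A x) = 0 :=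
  CliffordAlgebra.contractLeft_contractLeft _ _

theorem boundary_boundary_extMonomial_mul (l : List A.hyperplanes) (x : E K A) :
    boundary K A (boundary K A (extMonomial K l) * x) =
      -((-1 : K) ^ l.length • (boundary K A (extMonomial K l) * boundary K A x)) := by
  have h := congrArg (boundary K A) (boundary_extMonomial_mul l x)
  rw [boundary_boundary, map_add, map_smul, boundary_extMonomial_mul, boundary_boundary, mul_zero,
    smul_zero, add_zero] at h
  exact eq_neg_of_add_eq_zero_left h.symm

theorem boundary_extMonomial (l : List A.hyperplanes) :
    boundary K A (extMonomial K l) =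
      ∑ k ∈ Finset.range l.length, (-1 : K) ^ k • extMonomial K (l.eraseIdx k) := by
  induction l with
  | nil => simp [boundary_one]
  | cons H l ih =>
    rw [boundary_extMonomial_cons, ih, List.length_cons, Finset.sum_range_succ', Finset.mul_sum]
    simp only [List.eraseIdx_cons_succ, List.eraseIdx_zero, List.tail_cons,
      extMonomial_cons K H (List.eraseIdx _ _), extMonomial_singleton, pow_zero, one_smul,
      pow_succ, mul_neg, mul_one, neg_smul, Finset.sum_neg_distrib, mul_smul_comm]
    abel

theorem mul_boundary_mul_eq_sum (t l t' : List A.hyperplanes) :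
    extMonomial K t * boundary K A (extMonomial K l) * extMonomial K t' =
      ∑ k ∈ Finset.range l.length, (-1 : K) ^ k • extMonomial K (t ++ l.eraseIdx k ++ t') := by
  simp only [boundary_extMonomial, Finset.mul_sum, Finset.sum_mul, extMonomial_append,
    mul_smul_comm, smul_mul_assoc]

theorem extMonomial_singleton_mul_boundary (H : A.hyperplanes) (l : List A.hyperplanes) :
    extMonomial K [H] * boundary K A (extMonomial K (H :: l)) = extMonomial K (H :: l) := by
  rw [boundary_extMonomial_cons, mul_sub, ← mul_assoc, extMonomial_singleton,
    ExteriorAlgebra.ι_sq_zero, zero_mul, sub_zero, extMonomial_cons]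

variable {W : Type*} [AddCommGroup W] [Module F W] {B : HyperplaneArrangement F W}

theorem extMap_boundary (β : B.hyperplanes → A.hyperplanes) (l : List B.hyperplanes) :
    extMap K β (boundary K B (extMonomial K l)) = boundary K A (extMonomial K (l.map β)) := by
  simp [boundary_extMonomial, List.eraseIdx_map]

theorem extRestrict_boundary (β : B.hyperplanes ↪ A.hyperplanes) (l : List B.hyperplanes) :
    extRestrict K β (boundary K A (extMonomial K (l.map β))) =
      boundary K B (extMonomial K l) := by
  simp [boundary_extMonomial, List.eraseIdx_map]

end Boundary

end HyperplaneArrangement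

namespace HyperplaneArrangement

variable {F V : Type*} [Field F] [AddCommGroup V] [Module F V] (K : Type*) [CommRing K]
  (A : HyperplaneArrangement F V)

section OrlikSolomonMonomials

theorem osProj_mul (x y : E K A) : osProj K A (x * y) = osProj K A x * osProj K A y := rfl

theorem osProj_surjective : Function.Surjective (osProj K A) := Quotient.mk_surjective

theorem osProj_eq_zero_iff {x : E K A} : osProj K A x = 0 ↔ x ∈ osIdeal K A := by
  rw [TwoSidedIdeal.mem_iff]
  exact RingCon.eq _

/-- The image in the Orlik–Solomon algebra of the monomial of a list of hyperplanes. -/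
noncomputable def osList (l : List A.hyperplanes) : OrlikSolomon K A :=
  osProj K A (extMonomial K l)

theorem osList_append (l l' : List A.hyperplanes) :
    osList K A (l ++ l') = osList K A l * osList K A l' := by
  simp only [osList, extMonomial_append, osProj_mul]

theorem osList_mul_comm (l l' : List A.hyperplanes) :
    osList K A l * osList K A l' =
      (-1 : K) ^ (l.length * l'.length) • (osList K A l' * osList K A l) := by
  simp only [osList, ← osProj_mul, extMonomial_mul_comm K l l', map_smul]

theorem osDegree_eq_span (p : ℕ) :
    osDegree K A p = Submodule.span K (osList K A '' {l | l.length = p}) := by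
  rw [osDegree, exteriorPower_eq_span_extMonomial, ← Submodule.span_image, ← Set.image_comp]
  rfl

theorem span_range_osList : Submodule.span K (Set.range (osList K A)) = ⊤ := by
  have hrange : Set.range (osList K A) = osProj K A '' Set.range (extMonomial K) :=
    Set.range_comp _ _
  rw [hrange, Submodule.span_image, span_range_extMonomial, Submodule.map_top,
    LinearMap.range_eq_top.2 (osProj_surjective K A)]

variable {K A}

theorem linearMap_ext_osList {N : Type*} [AddCommMonoid N] [Module K N]
    {f g : OrlikSolomon K A →ₗ[K] N} (h : ∀ l, f (osList K A l) = g (osList K A l)) : f = g :=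
  LinearMap.ext_on (span_range_osList K A) (Set.forall_mem_range.2 h)

theorem osList_eq_zero_of_inter_eq_bot {l : List A.hyperplanes} (h : A.inter l = ⊥) :
    osList K A l = 0 := by
  rw [osList, osProj_eq_zero_iff]
  refine TwoSidedIdeal.subset_span (Or.inl ⟨l.length, l.get, ?_, ?_⟩)
  · rw [interTuple_eq_inter, List.ofFn_get, h]
  · rw [eTuple_eq_extMonomial, List.ofFn_get]

theorem osProj_boundary_of_dependent {l : List A.hyperplanes} (h : A.Dependent l) :
    osProj K A (boundary K A (extMonomial K l)) = 0 := by
  rw [osProj_eq_zero_iff]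
  refine TwoSidedIdeal.subset_span (Or.inr ⟨l.length, l.get, ?_, ?_⟩)
  · rwa [isDependent_iff_dependent_ofFn, List.ofFn_get]
  · rw [eTuple_eq_extMonomial, List.ofFn_get]

theorem osList_eq_zero_of_dependent {l : List A.hyperplanes} (h : A.Dependent l) :
    osList K A l = 0 := by
  obtain ⟨H, t, rfl⟩ := List.exists_cons_of_ne_nil h.ne_nil
  rw [osList, ← extMonomial_singleton_mul_boundary, osProj_mul, osProj_boundary_of_dependent h,
    mul_zero]

theorem osProj_mul_boundary_mul_of_dependent {l : List A.hyperplanes} (h : A.Dependent l)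
    (x y : E K A) : osProj K A (x * boundary K A (extMonomial K l) * y) = 0 := by
  rw [osProj_mul, osProj_mul, osProj_boundary_of_dependent h, mul_zero, zero_mul]

theorem osProj_boundary_mul_boundary_mul_of_dependent {l : List A.hyperplanes}
    (h : A.Dependent l) (t : List A.hyperplanes) (y : E K A) :
    osProj K A (boundary K A (extMonomial K t * boundary K A (extMonomial K l) * y)) = 0 := by
  rw [mul_assoc, boundary_extMonomial_mul, boundary_boundary_extMonomial_mul]
  simp [osProj_mul, osProj_boundary_of_dependent h]

end OrlikSolomonMonomials

section Lift

variable {K A} {N : Type*} [AddCommGroup N] [Module K N]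

open Pointwise in
theorem eq_zero_of_mem_osIdeal (f : E K A →ₗ[K] N)
    (hbot : ∀ l, A.inter l = ⊥ → f (extMonomial K l) = 0)
    (hdep : ∀ t l t', A.Dependent l →
      f (extMonomial K t * boundary K A (extMonomial K l) * extMonomial K t') = 0)
    {x : E K A} (hx : x ∈ osIdeal K A) : f x = 0 := by
  have of_monomials : ∀ z, (∀ t t', f (extMonomial K t * z * extMonomial K t') = 0) →
      ∀ a b, f (a * z * b) = 0 := by
    intro z hz a b
    have hright : ∀ t, f ∘ₗ LinearMap.mulLeft K (extMonomial K t * z) = 0 := fun t =>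
      linearMap_ext_extMonomial (hz t)
    have hleft : f ∘ₗ LinearMap.mulRight K b ∘ₗ LinearMap.mulRight K z = 0 :=
      linearMap_ext_extMonomial fun t => LinearMap.congr_fun (hright t) b
    exact LinearMap.congr_fun hleft a
  rw [osIdeal, TwoSidedIdeal.mem_span_iff_mem_addSubgroup_closure] at hx
  refine (AddSubgroup.closure_le (K := f.toAddMonoidHom.ker)).2 ?_ hx
  rintro _ ⟨_, ⟨a, -, z, hz, rfl⟩, b, -, rfl⟩
  refine of_monomials z (fun t t' => ?_) a b
  rcases hz with ⟨p, S, hS, rfl⟩ | ⟨p, S, hS, rfl⟩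
  · rw [eTuple_eq_extMonomial, ← extMonomial_append, ← extMonomial_append]
    rw [interTuple_eq_inter] at hS
    exact hbot _ (by simp [hS])
  · rw [eTuple_eq_extMonomial]
    exact hdep _ _ _ ((isDependent_iff_dependent_ofFn S).1 hS)

/-- The linear map from the Orlik–Solomon algebra induced by a linear map on the exterior algebra
that kills the multiples of the generators of the Orlik–Solomon ideal by monomials. -/
noncomputable def osLift (f : E K A →ₗ[K] N)
    (hbot : ∀ l, A.inter l = ⊥ → f (extMonomial K l) = 0)
    (hdep : ∀ t l t', A.Dependent l →
      f (extMonomial K t * boundary K A (extMonomial K l) * extMonomial K t') = 0) :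
    OrlikSolomon K A →ₗ[K] N :=
  (LinearMap.ker (osProj K A)).liftQ f (fun _ hx =>
      eq_zero_of_mem_osIdeal f hbot hdep ((osProj_eq_zero_iff K A).1 hx)) ∘ₗ
    ((osProj K A).quotKerEquivOfSurjective (osProj_surjective K A)).symm.toLinearMap

@[simp]
theorem osLift_osProj (f : E K A →ₗ[K] N) (hbot hdep) (x : E K A) :
    osLift f hbot hdep (osProj K A x) = f x := by
  rw [osLift, LinearMap.comp_apply, LinearEquiv.coe_coe,
    ← LinearMap.quotKerEquivOfSurjective_apply_mk (osProj K A) (osProj_surjective K A) x,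
    LinearEquiv.symm_apply_apply]
  exact Submodule.liftQ_apply _ _ _

end Lift

section FlatProj

variable {A}

/-- The projection of the exterior algebra onto the span of the monomials whose intersection
satisfies `P`. -/
noncomputable def flatProj (P : AffineSubspace F V → Prop) : E K A →ₗ[K] E K A :=
  extProj K fun s => P (⨅ H ∈ s, H.1)

open Classical in
@[simp]
theorem flatProj_extMonomial (P : AffineSubspace F V → Prop) (l : List A.hyperplanes) :
    flatProj K P (extMonomial K l) = if P (A.inter l) then extMonomial K l else 0 :=
  extProj_extMonomial ..

variable {K} {N : Type*} [AddCommGroup N] [Module K N] [FiniteDimensional F V]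

/-- Removing a hyperplane from the dependent list `l` either leaves it dependent or does not change
its intersection, so up to terms killed by `g` all monomials of the boundary have the same flat. -/
theorem map_flatProj_mul_boundary_mul_eq_zero (g : E K A →ₗ[K] N)
    {P : AffineSubspace F V → Prop} {t l t' : List A.hyperplanes} (hl : A.Dependent l)
    (hdep : ∀ m ⊆ l, A.Dependent m → P (A.inter (t ++ m ++ t')) ∨ P (A.inter (t ++ l ++ t')) →
      g (extMonomial K (t ++ m ++ t')) = 0)
    (hboundary : P (A.inter (t ++ l ++ t')) →
      g (extMonomial K t * boundary K A (extMonomial K l) * extMonomial K t') = 0) :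
    g (flatProj K P (extMonomial K t * boundary K A (extMonomial K l) * extMonomial K t')) = 0 := by
  classical
  have hterm : ∀ k ∈ Finset.range l.length,
      g (flatProj K P (extMonomial K (t ++ l.eraseIdx k ++ t'))) =
        if P (A.inter (t ++ l ++ t')) then g (extMonomial K (t ++ l.eraseIdx k ++ t')) else 0 := by
    intro k hk
    rw [flatProj_extMonomial, apply_ite g, map_zero]
    rcases hl.eraseIdx (Finset.mem_range.1 hk) with hdep' | heq
    · have hzero := hdep _ (List.eraseIdx_subset ..) hdep'
      split_ifs <;> simp_all only [true_or, or_true]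
    · simp only [inter_append, heq]
  rw [mul_boundary_mul_eq_sum] at hboundary ⊢
  simp only [map_sum, map_smul] at hboundary ⊢
  rw [Finset.sum_congr rfl fun k hk => congrArg _ (hterm k hk)]
  split_ifs with hP
  · exact hboundary hP
  · simp

variable (K) in
/-- The projection of the Orlik–Solomon algebra onto the span of the monomials whose intersection
satisfies `P`. -/
noncomputable def gradeProj (P : AffineSubspace F V → Prop) :
    OrlikSolomon K A →ₗ[K] OrlikSolomon K A :=
  osLift (osProj K A ∘ₗ flatProj K P)
    (fun l hl => by
      have hzero := osList_eq_zero_of_inter_eq_bot (K := K) hl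
      rw [LinearMap.comp_apply, flatProj_extMonomial]
      split_ifs
      exacts [hzero, map_zero _])
    (fun t l t' hl => map_flatProj_mul_boundary_mul_eq_zero (osProj K A) hl
      (fun m _ hm _ => by
        change osList K A _ = 0
        rw [osList_append, osList_append, osList_eq_zero_of_dependent hm, mul_zero, zero_mul])
      (fun _ => osProj_mul_boundary_mul_of_dependent hl _ _))

open Classical in
theorem gradeProj_osList (P : AffineSubspace F V → Prop) (l : List A.hyperplanes) :
    gradeProj K P (osList K A l) = if P (A.inter l) then osList K A l else 0 := by
  rw [gradeProj, osList, osLift_osProj, LinearMap.comp_apply, flatProj_extMonomial,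
    apply_ite (osProj K A), map_zero]

end FlatProj

section OSBoundary

variable [FiniteDimensional F V]

/-- The boundary map of the Orlik–Solomon algebra. The boundary map of the exterior algebra does
not preserve the Orlik–Solomon ideal, because a list with empty intersection may have sublists with
nonempty intersection; the monomials with empty intersection are therefore discarded first. -/
noncomputable def osBoundary : OrlikSolomon K A →ₗ[K] OrlikSolomon K A :=
  osLift (osProj K A ∘ₗ boundary K A ∘ₗ flatProj K (· ≠ ⊥))
    (fun l hl => by simp [hl])
    (fun t l t' hl => map_flatProj_mul_boundary_mul_eq_zero (osProj K A ∘ₗ boundary K A) hl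
      (fun m hml hm hne => osProj_boundary_of_dependent (hm.append_append t t' (by
        have hsub : t ++ m ++ t' ⊆ t ++ l ++ t' := by grind
        exact hne.elim id fun hl => ne_bot_of_le_ne_bot hl (A.inter_anti hsub))))
      (fun _ => osProj_boundary_mul_boundary_mul_of_dependent hl _ _))

variable {K A}

theorem osBoundary_osList {l : List A.hyperplanes} (h : A.inter l ≠ ⊥) :
    osBoundary K A (osList K A l) = osProj K A (boundary K A (extMonomial K l)) := by
  rw [osBoundary, osList, osLift_osProj, LinearMap.comp_apply, LinearMap.comp_apply,
    flatProj_extMonomial, if_pos h]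

theorem osBoundary_osList_eq_sum {l : List A.hyperplanes} (h : A.inter l ≠ ⊥) :
    osBoundary K A (osList K A l) =
      ∑ k ∈ Finset.range l.length, (-1 : K) ^ k • osList K A (l.eraseIdx k) := by
  rw [osBoundary_osList h, boundary_extMonomial, map_sum]
  simp only [map_smul, osList]

theorem osList_singleton_mul_osBoundary {l : List A.hyperplanes} {H : A.hyperplanes}
    (h : A.inter l ≠ ⊥) (hH : A.inter l ≤ H) :
    osList K A [H] * osBoundary K A (osList K A l) = osList K A l := by
  have hboundary := osProj_boundary_of_dependent (K := K) (dependent_cons h hH)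
  rw [boundary_extMonomial_cons, map_sub, sub_eq_zero, osProj_mul] at hboundary
  rw [osBoundary_osList h]
  exact hboundary.symm

theorem osBoundary_osList_append {l l' : List A.hyperplanes} (h : A.inter (l ++ l') ≠ ⊥) :
    osBoundary K A (osList K A (l ++ l')) = osBoundary K A (osList K A l) * osList K A l' +
      (-1 : K) ^ l.length • (osList K A l * osBoundary K A (osList K A l')) := by
  rw [osBoundary_osList h, extMonomial_append, boundary_extMonomial_mul]
  rw [inter_append] at h
  rw [osBoundary_osList (ne_bot_of_le_ne_bot h inf_le_left),
    osBoundary_osList (ne_bot_of_le_ne_bot h inf_le_right), map_add, map_smul, osProj_mul,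
    osProj_mul, osList, osList]

end OSBoundary

end HyperplaneArrangement

theorem disjoint_iSup_ker_of_proj {K M N ι : Type*} [Semiring K] [AddCommMonoid M]
    [AddCommMonoid N] [Module K M] [Module K N] {f : M →ₗ[K] N} {S : ι → Submodule K M}
    (π : ι → N →ₗ[K] N) (hself : ∀ i, ∀ y ∈ S i, π i (f y) = f y)
    (hne : ∀ i j, i ≠ j → ∀ y ∈ S j, π i (f y) = 0)
    (hdisj : ∀ i, Disjoint (S i) (LinearMap.ker f)) : Disjoint (⨆ i, S i) (LinearMap.ker f) := by
  simp only [Submodule.disjoint_def, LinearMap.mem_ker] at hdisj ⊢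
  intro y hy hfy
  obtain ⟨c, hc, rfl⟩ := (Submodule.mem_iSup_iff_exists_finsupp _ _).1 hy
  refine Finset.sum_eq_zero fun i hi => hdisj i _ (hc i) ?_
  have hπ := congrArg (π i) hfy
  rw [map_finsuppSum, map_finsuppSum, map_zero, Finsupp.sum, Finset.sum_eq_single_of_mem i hi] at hπ
  · rwa [hself i _ (hc i)] at hπ
  · exact fun j _ hji => hne i j hji.symm _ (hc j)

namespace HyperplaneArrangement

variable {F V : Type*} [Field F] [AddCommGroup V] [Module F V] {A : HyperplaneArrangement F V}
  {I J : Set (AffineSubspace F V)}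

section Decomposition

/-- Among the elements of `I` that contain `X` there is a least one, and it is not the whole
space. -/
def HasLeastAbove (I : Set (AffineSubspace F V)) (X : AffineSubspace F V) : Prop :=
  ∃ Z ≠ ⊤, IsLeast {Y ∈ I | X ≤ Y} Z

variable (A I) in
/-- Ideals of the intersection poset, as sets of affine subspaces. -/
structure IsFlatIdeal : Prop where
  bot_notMem : ⊥ ∉ I
  top_mem : ⊤ ∈ I
  exists_inter : ∀ X ∈ I, ∃ l, X = A.inter l
  inter_mem : ∀ X ∈ I, ∀ l, X ≤ A.inter l → A.inter l ∈ I

theorem IsFlatIdeal.ne_bot (hI : A.IsFlatIdeal I) {X : AffineSubspace F V} (hX : X ∈ I) : X ≠ ⊥ :=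
  ne_of_mem_of_not_mem hX hI.bot_notMem

theorem IsFlatIdeal.exists_hyperplane_ge (hI : A.IsFlatIdeal I) {X : AffineSubspace F V}
    (hX : X ∈ I) (hne : X ≠ ⊤) : ∃ H : A.hyperplanes, X ≤ H := by
  obtain ⟨_ | ⟨H, l⟩, rfl⟩ := hI.exists_inter X hX
  · exact absurd A.inter_nil hne
  · exact ⟨H, A.inter_le_of_mem List.mem_cons_self⟩

theorem IsFlatIdeal.inter_eraseIdx_mem (hI : A.IsFlatIdeal I) {t : List A.hyperplanes}
    (ht : A.inter t ∈ I) (k : ℕ) : A.inter (t.eraseIdx k) ∈ I :=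
  hI.inter_mem _ ht _ (A.inter_le_inter_eraseIdx t k)

variable (A I J) in
/-- Decompositions of the intersection poset into two ideals, as sets of affine subspaces. This is
`IsIdealDecomposition ![I, J]` in a form in which the flats are intersections of lists. -/
structure IsDecomposition : Prop where
  left : A.IsFlatIdeal I
  right : A.IsFlatIdeal J
  hasLeastAbove : ∀ l, l ≠ [] → A.inter l ≠ ⊥ →
    HasLeastAbove I (A.inter l) ∨ HasLeastAbove J (A.inter l)
  inf_ne_bot : ∀ X ∈ I, ∀ Y ∈ J, X ⊓ Y ≠ ⊥
  affineCodim_inf : ∀ X ∈ I, ∀ Y ∈ J, affineCodim (X ⊓ Y) = affineCodim X + affineCodim Y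

namespace IsDecomposition

theorem symm (h : A.IsDecomposition I J) : A.IsDecomposition J I where
  left := h.right
  right := h.left
  hasLeastAbove l hl hne := (h.hasLeastAbove l hl hne).symm
  inf_ne_bot X hX Y hY := inf_comm X Y ▸ h.inf_ne_bot Y hY X hX
  affineCodim_inf X hX Y hY := by rw [inf_comm, h.affineCodim_inf Y hY X hX, add_comm]

variable [FiniteDimensional F V]

theorem eq_of_isLeast (h : A.IsDecomposition I J) {X Y Z : AffineSubspace F V} (hX : X ∈ I)
    (hY : Y ∈ J) (hZ : IsLeast {W ∈ I | X ⊓ Y ≤ W} Z) : X = Z := by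
  have hZX : Z ≤ X := hZ.2 ⟨hX, inf_le_left⟩
  refine (eq_of_le_of_affineCodim_le (h.left.ne_bot hZ.1.1) hZX ?_).symm
  have hcodimX := h.affineCodim_inf X hX Y hY
  have hcodimZ := h.affineCodim_inf Z hZ.1.1 Y hY
  rw [le_antisymm (inf_le_inf_right Y hZX) (le_inf hZ.1.2 inf_le_right)] at hcodimZ
  omega

theorem length_eq_affineCodim (h : A.IsDecomposition I J) {t : List A.hyperplanes}
    (ht : A.inter t ∈ I) (hdep : ¬ A.Dependent t) : t.length = affineCodim (A.inter t) :=
  le_antisymm (not_lt.1 fun hlt => hdep ⟨h.left.ne_bot ht, hlt⟩)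
    (affineCodim_inter_le (h.left.ne_bot ht))

theorem not_inter_eraseIdx_inf_le (h : A.IsDecomposition I J) {t : List A.hyperplanes}
    {X : AffineSubspace F V} (ht : A.inter t ∈ I) (hX : X ∈ J) (hdep : ¬ A.Dependent t) {k : ℕ}
    (hk : k < t.length) : ¬ A.inter (t.eraseIdx k) ⊓ X ≤ A.inter t := by
  intro hle
  have herase := h.left.inter_eraseIdx_mem ht k
  have heq : A.inter (t.eraseIdx k) ⊓ X = A.inter t ⊓ X :=
    le_antisymm (le_inf hle inf_le_right) (inf_le_inf_right _ (A.inter_le_inter_eraseIdx t k))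
  have hcodim := h.affineCodim_inf _ herase _ hX
  rw [heq, h.affineCodim_inf _ ht _ hX, ← h.length_eq_affineCodim ht hdep] at hcodim
  have hlength := affineCodim_inter_le (h.left.ne_bot herase)
  rw [List.length_eraseIdx_of_lt hk] at hlength
  omega

end IsDecomposition

end Decomposition

section Spanning

variable (K : Type*) [CommRing K]

variable (A I J) in
/-- The span of the products of a monomial of `I` by a monomial of `J`, of total length `n`, where
both monomials have intersection containing `X`. -/
noncomputable def productSpan (n : ℕ) (X : AffineSubspace F V) : Submodule K (OrlikSolomon K A) :=
  Submodule.span K {x | ∃ t t', A.inter t ∈ I ∧ A.inter t' ∈ J ∧ t.length + t'.length = n ∧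
    X ≤ A.inter t ∧ X ≤ A.inter t' ∧ x = osList K A t * osList K A t'}

variable {K}

theorem productSpan_le_swap (n : ℕ) (X : AffineSubspace F V) :
    productSpan A I J K n X ≤ productSpan A J I K n X := by
  refine Submodule.span_le.2 ?_
  rintro _ ⟨t, t', ht, ht', hlen, hXt, hXt', rfl⟩
  rw [osList_mul_comm]
  exact Submodule.smul_mem _ _ (Submodule.subset_span
    ⟨t', t, ht', ht, by rwa [add_comm], hXt', hXt, rfl⟩)

theorem osList_singleton_mul_mem_productSpan (hI : A.IsFlatIdeal I) {n : ℕ}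
    {X Y Z : AffineSubspace F V} (hXY : X ≤ Y) (hZ : IsLeast {W ∈ I | X ≤ W} Z)
    {H : A.hyperplanes} (hZH : Z ≤ H) {x : OrlikSolomon K A} (hx : x ∈ productSpan A I J K n Y) :
    osList K A [H] * x ∈ productSpan A I J K (n + 1) X := by
  suffices hle : productSpan A I J K n Y ≤
      (productSpan A I J K (n + 1) X).comap (LinearMap.mulLeft K (osList K A [H])) from hle hx
  refine Submodule.span_le.2 ?_
  rintro _ ⟨t, t', ht, ht', hlen, hYt, hYt', rfl⟩
  have hZt : Z ≤ A.inter (H :: t) := by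
    rw [inter_cons]
    exact le_inf hZH (hZ.2 ⟨ht, hXY.trans hYt⟩)
  refine Submodule.subset_span ⟨H :: t, t', hI.inter_mem Z hZ.1.1 _ hZt, ht', ?_,
    hZ.1.2.trans hZt, hXY.trans hYt', ?_⟩
  · rw [List.length_cons]
    omega
  · rw [LinearMap.mulLeft_apply, ← mul_assoc, ← osList_append, List.singleton_append]

variable [FiniteDimensional F V]

theorem osList_mem_productSpan_of_hasLeastAbove (hI : A.IsFlatIdeal I) {n : ℕ}
    {l : List A.hyperplanes} (hlen : l.length = n + 1) (hne : A.inter l ≠ ⊥)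
    (hleast : HasLeastAbove I (A.inter l))
    (ih : ∀ m : List A.hyperplanes, m.length = n →
      osList K A m ∈ productSpan A I J K n (A.inter m)) :
    osList K A l ∈ productSpan A I J K (n + 1) (A.inter l) := by
  obtain ⟨Z, hZtop, hZ⟩ := hleast
  obtain ⟨H, hZH⟩ := hI.exists_hyperplane_ge hZ.1.1 hZtop
  rw [← osList_singleton_mul_osBoundary hne (hZ.1.2.trans hZH), osBoundary_osList_eq_sum hne,
    Finset.mul_sum]
  refine Submodule.sum_mem _ fun k hk => ?_
  rw [mul_smul_comm]
  refine Submodule.smul_mem _ _ (osList_singleton_mul_mem_productSpan hI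
    (A.inter_le_inter_eraseIdx l k) hZ hZH (ih _ ?_))
  rw [List.length_eraseIdx_of_lt (Finset.mem_range.1 hk), hlen, Nat.add_sub_cancel]

theorem IsDecomposition.osList_mem_productSpan (h : A.IsDecomposition I J)
    (l : List A.hyperplanes) : osList K A l ∈ productSpan A I J K l.length (A.inter l) := by
  induction hn : l.length generalizing l with
  | zero =>
    obtain rfl := List.length_eq_zero_iff.1 hn
    refine Submodule.subset_span ⟨[], [], ?_, ?_, rfl, le_rfl, le_rfl, ?_⟩
    · exact A.inter_nil ▸ h.left.top_mem
    · exact A.inter_nil ▸ h.right.top_mem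
    · rw [← osList_append, List.append_nil]
  | succ n ih =>
    by_cases hne : A.inter l = ⊥
    · rw [osList_eq_zero_of_inter_eq_bot hne]
      exact zero_mem _
    rcases h.hasLeastAbove l (List.ne_nil_of_length_eq_add_one hn) hne with hleast | hleast
    · exact osList_mem_productSpan_of_hasLeastAbove h.left hn hne hleast ih
    · exact productSpan_le_swap _ _ (osList_mem_productSpan_of_hasLeastAbove h.right hn hne hleast
        fun m hm => productSpan_le_swap _ _ (ih m hm))

end Spanning

end HyperplaneArrangement

namespace HyperplaneArrangement

variable {F V : Type*} [Field F] [AddCommGroup V] [Module F V] {A : HyperplaneArrangement F V}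
  {I J : Set (AffineSubspace F V)}

section Injectivity

variable (K : Type*) [CommRing K]

variable (A I J) in
/-- The span of the tensors of a monomial of `I` by a monomial of `J` whose intersections meet in
`X`. -/
noncomputable def joinSpan (X : AffineSubspace F V) :
    Submodule K (OrlikSolomon K A ⊗[K] OrlikSolomon K A) :=
  Submodule.span K {y | ∃ t t', A.inter t ∈ I ∧ A.inter t' ∈ J ∧
    A.inter t ⊓ A.inter t' = X ∧ y = osList K A t ⊗ₜ[K] osList K A t'}

variable {K} {X : AffineSubspace F V} {y : OrlikSolomon K A ⊗[K] OrlikSolomon K A}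

theorem comm_mem_joinSpan (hy : y ∈ joinSpan A I J K X) :
    TensorProduct.comm K _ _ y ∈ joinSpan A J I K X := by
  suffices hle : joinSpan A I J K X ≤
      (joinSpan A J I K X).comap (TensorProduct.comm K _ _).toLinearMap from hle hy
  refine Submodule.span_le.2 ?_
  rintro _ ⟨t, t', ht, ht', hX, rfl⟩
  exact Submodule.subset_span ⟨t', t, ht', ht, by rwa [inf_comm], rfl⟩

theorem disjoint_joinSpan_top_ker_mul' :
    Disjoint (joinSpan A I J K ⊤) (LinearMap.ker (LinearMap.mul' K _)) := by
  refine LinearMap.disjoint_ker.2 fun y hy hmul => ?_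
  have hle : joinSpan A I J K ⊤ ≤ Submodule.span K {osList K A [] ⊗ₜ[K] osList K A []} := by
    refine Submodule.span_mono ?_
    rintro _ ⟨t, t', -, -, hX, rfl⟩
    obtain ⟨ht, ht'⟩ := inf_eq_top_iff.1 hX
    rw [A.inter_eq_top_iff.1 ht, A.inter_eq_top_iff.1 ht']
    rfl
  obtain ⟨c, rfl⟩ := Submodule.mem_span_singleton.1 (hle hy)
  rw [map_smul, LinearMap.mul'_apply, ← osList_append, List.append_nil] at hmul
  rw [TensorProduct.smul_tmul', hmul, TensorProduct.zero_tmul]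

variable [FiniteDimensional F V]

open Classical in
theorem gradeProj_mul'_of_mem_joinSpan (hy : y ∈ joinSpan A I J K X)
    (P : AffineSubspace F V → Prop) :
    gradeProj K P (LinearMap.mul' K _ y) = if P X then LinearMap.mul' K _ y else 0 := by
  suffices hEqOn : Set.EqOn (gradeProj K P ∘ₗ LinearMap.mul' K (OrlikSolomon K A))
      (if P X then LinearMap.mul' K (OrlikSolomon K A) else 0 :
        OrlikSolomon K A ⊗[K] OrlikSolomon K A →ₗ[K] OrlikSolomon K A) (joinSpan A I J K X) by
    refine (hEqOn hy).trans ?_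
    split_ifs <;> rfl
  refine LinearMap.eqOn_span' ?_
  rintro _ ⟨t, t', -, -, rfl, rfl⟩
  rw [LinearMap.comp_apply, LinearMap.mul'_apply, ← osList_append, gradeProj_osList, inter_append]
  split_ifs
  · rw [LinearMap.mul'_apply, osList_append]
  · rfl

theorem disjoint_iSup_joinSpan_ker_mul' {ι : Type*} {X : ι → AffineSubspace F V}
    (hX : Function.Injective X)
    (hdisj : ∀ i, Disjoint (joinSpan A I J K (X i)) (LinearMap.ker (LinearMap.mul' K _))) :
    Disjoint (⨆ i, joinSpan A I J K (X i)) (LinearMap.ker (LinearMap.mul' K _)) := by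
  refine disjoint_iSup_ker_of_proj (fun i => gradeProj K (· = X i)) ?_ ?_ hdisj
  · intro i y hy
    rw [gradeProj_mul'_of_mem_joinSpan hy, if_pos rfl]
  · intro i j hij y hy
    rw [gradeProj_mul'_of_mem_joinSpan hy, if_neg fun h => hij (hX h.symm)]

namespace IsDecomposition

theorem gradeProj_osBoundary_mul (h : A.IsDecomposition I J) {t t' : List A.hyperplanes}
    (ht : A.inter t ∈ I) (ht' : A.inter t' ∈ J) :
    gradeProj K (fun Y => ¬ Y ≤ A.inter t) (osBoundary K A (osList K A t * osList K A t')) =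
      osBoundary K A (osList K A t) * osList K A t' := by
  by_cases hdep : A.Dependent t
  · simp [osList_eq_zero_of_dependent hdep]
  have hne : A.inter (t ++ t') ≠ ⊥ := inter_append A t t' ▸ h.inf_ne_bot _ ht _ ht'
  have hleft : gradeProj K (fun Y => ¬ Y ≤ A.inter t)
      (osBoundary K A (osList K A t) * osList K A t') =
        osBoundary K A (osList K A t) * osList K A t' := by
    simp only [osBoundary_osList_eq_sum (h.left.ne_bot ht), Finset.sum_mul, smul_mul_assoc,
      ← osList_append, map_sum, map_smul]
    refine Finset.sum_congr rfl fun k hk => ?_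
    rw [gradeProj_osList, if_pos]
    rw [inter_append]
    exact h.not_inter_eraseIdx_inf_le ht ht' hdep (Finset.mem_range.1 hk)
  have hright : gradeProj K (fun Y => ¬ Y ≤ A.inter t)
      (osList K A t * osBoundary K A (osList K A t')) = 0 := by
    simp only [osBoundary_osList_eq_sum (h.right.ne_bot ht'), Finset.mul_sum, mul_smul_comm,
      ← osList_append, map_sum, map_smul]
    refine Finset.sum_eq_zero fun k _ => ?_
    rw [gradeProj_osList, if_neg (by simp), smul_zero]
  rw [← osList_append, osBoundary_osList_append hne, map_add, map_smul, hleft, hright, smul_zero,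
    add_zero]

theorem gradeProj_osBoundary_mul' (h : A.IsDecomposition I J) {Z : AffineSubspace F V}
    (hZ : IsLeast {Y ∈ I | X ≤ Y} Z) (hy : y ∈ joinSpan A I J K X) :
    gradeProj K (fun Y => ¬ Y ≤ Z) (osBoundary K A (LinearMap.mul' K _ y)) =
      LinearMap.mul' K _ ((osBoundary K A).rTensor _ y) := by
  suffices hEqOn : Set.EqOn (gradeProj K (fun Y => ¬ Y ≤ Z) ∘ₗ osBoundary K A ∘ₗ
      LinearMap.mul' K _) (LinearMap.mul' K _ ∘ₗ (osBoundary K A).rTensor _)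
      (joinSpan A I J K X) from hEqOn hy
  refine LinearMap.eqOn_span' ?_
  rintro _ ⟨t, t', ht, ht', rfl, rfl⟩
  obtain rfl := h.eq_of_isLeast ht ht' hZ
  exact h.gradeProj_osBoundary_mul ht ht'

theorem mulLeft_rTensor_osBoundary (h : A.IsDecomposition I J) {Z : AffineSubspace F V}
    (hZ : IsLeast {Y ∈ I | X ≤ Y} Z) {H : A.hyperplanes} (hZH : Z ≤ H)
    (hy : y ∈ joinSpan A I J K X) :
    (LinearMap.mulLeft K (osList K A [H])).rTensor _ ((osBoundary K A).rTensor _ y) = y := by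
  suffices hEqOn : Set.EqOn ((LinearMap.mulLeft K (osList K A [H])).rTensor _ ∘ₗ
      (osBoundary K A).rTensor _) (LinearMap.id : _ →ₗ[K] _) (joinSpan A I J K X) from hEqOn hy
  refine LinearMap.eqOn_span' ?_
  rintro _ ⟨t, t', ht, ht', rfl, rfl⟩
  obtain rfl := h.eq_of_isLeast ht ht' hZ
  simp only [LinearMap.comp_apply, LinearMap.rTensor_tmul, LinearMap.mulLeft_apply,
    LinearMap.id_apply]
  rw [osList_singleton_mul_osBoundary (h.left.ne_bot ht) hZH]

theorem rTensor_osBoundary_mem_iSup_joinSpan (h : A.IsDecomposition I J)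
    (hy : y ∈ joinSpan A I J K X) :
    (osBoundary K A).rTensor _ y ∈ ⨆ Y : {Y // X < Y}, joinSpan A I J K Y.1 := by
  suffices hle : joinSpan A I J K X ≤
      (⨆ Y : {Y // X < Y}, joinSpan A I J K Y.1).comap ((osBoundary K A).rTensor _) from hle hy
  refine Submodule.span_le.2 ?_
  rintro _ ⟨t, t', ht, ht', rfl, rfl⟩
  by_cases hdep : A.Dependent t
  · simp [osList_eq_zero_of_dependent hdep]
  rw [SetLike.mem_coe, Submodule.mem_comap, LinearMap.rTensor_tmul,
    osBoundary_osList_eq_sum (h.left.ne_bot ht), TensorProduct.sum_tmul]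
  refine Submodule.sum_mem _ fun k hk => ?_
  rw [← TensorProduct.smul_tmul']
  have hlt : A.inter t ⊓ A.inter t' < A.inter (t.eraseIdx k) ⊓ A.inter t' :=
    lt_of_le_not_ge (inf_le_inf_right _ (A.inter_le_inter_eraseIdx t k)) fun hge =>
      h.not_inter_eraseIdx_inf_le ht ht' hdep (Finset.mem_range.1 hk) (hge.trans inf_le_left)
  exact Submodule.smul_mem _ _ (Submodule.mem_iSup_of_mem ⟨_, hlt⟩ (Submodule.subset_span
    ⟨t.eraseIdx k, t', h.left.inter_eraseIdx_mem ht k, ht', rfl, rfl⟩))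

theorem disjoint_joinSpan_ker_of_hasLeastAbove (h : A.IsDecomposition I J)
    (hX : HasLeastAbove I X)
    (ih : ∀ Y, X < Y → Disjoint (joinSpan A I J K Y) (LinearMap.ker (LinearMap.mul' K _))) :
    Disjoint (joinSpan A I J K X) (LinearMap.ker (LinearMap.mul' K _)) := by
  obtain ⟨Z, hZtop, hZ⟩ := hX
  obtain ⟨H, hZH⟩ := h.left.exists_hyperplane_ge hZ.1.1 hZtop
  refine LinearMap.disjoint_ker.2 fun y hy hmul => ?_
  have hboundary : (osBoundary K A).rTensor _ y = 0 :=
    LinearMap.disjoint_ker.1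
      (disjoint_iSup_joinSpan_ker_mul' Subtype.val_injective fun Y => ih Y.1 Y.2) _
      (h.rTensor_osBoundary_mem_iSup_joinSpan hy)
      (by rw [← h.gradeProj_osBoundary_mul' hZ hy, hmul, map_zero, map_zero])
  rw [← h.mulLeft_rTensor_osBoundary hZ hZH hy, hboundary, map_zero]

theorem mul'_comm_of_mem_joinSpan (h : A.IsDecomposition I J) {Z : AffineSubspace F V}
    (hZ : IsLeast {Y ∈ J | X ≤ Y} Z) (hy : y ∈ joinSpan A I J K X) :
    LinearMap.mul' K _ (TensorProduct.comm K _ _ y) =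
      (-1 : K) ^ (affineCodim Z * (affineCodim X - affineCodim Z)) • LinearMap.mul' K _ y := by
  suffices hEqOn : Set.EqOn (LinearMap.mul' K _ ∘ₗ (TensorProduct.comm K _ _).toLinearMap)
      ((-1 : K) ^ (affineCodim Z * (affineCodim X - affineCodim Z)) •
        LinearMap.mul' K (OrlikSolomon K A)) (joinSpan A I J K X) from hEqOn hy
  refine LinearMap.eqOn_span' ?_
  rintro _ ⟨t, t', ht, ht', rfl, rfl⟩
  obtain rfl := h.symm.eq_of_isLeast ht' ht (inf_comm (A.inter t) _ ▸ hZ)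
  by_cases hdep : A.Dependent t
  · simp [osList_eq_zero_of_dependent hdep]
  by_cases hdep' : A.Dependent t'
  · simp [osList_eq_zero_of_dependent hdep']
  rw [h.affineCodim_inf _ ht _ ht', Nat.add_sub_cancel, ← h.length_eq_affineCodim ht hdep,
    ← h.symm.length_eq_affineCodim ht' hdep']
  exact osList_mul_comm K A t' t

theorem disjoint_joinSpan_ker_of_swap (h : A.IsDecomposition I J) (hX : HasLeastAbove J X)
    (hdisj : Disjoint (joinSpan A J I K X) (LinearMap.ker (LinearMap.mul' K _))) :
    Disjoint (joinSpan A I J K X) (LinearMap.ker (LinearMap.mul' K _)) := by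
  obtain ⟨Z, -, hZ⟩ := hX
  refine LinearMap.disjoint_ker.2 fun y hy hmul => ?_
  refine (LinearEquiv.map_eq_zero_iff (TensorProduct.comm K _ _)).1
    (LinearMap.disjoint_ker.1 hdisj _ (comm_mem_joinSpan hy) ?_)
  rw [h.mul'_comm_of_mem_joinSpan hZ hy, hmul, smul_zero]

theorem disjoint_joinSpan_ker_mul' (h : A.IsDecomposition I J) (X : AffineSubspace F V) :
    Disjoint (joinSpan A I J K X) (LinearMap.ker (LinearMap.mul' K _)) := by
  induction hn : affineCodim X using Nat.strong_induction_on generalizing I J X with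
  | _ n ih =>
  rcases eq_or_ne X ⊤ with rfl | htop
  · exact disjoint_joinSpan_top_ker_mul'
  by_cases hX : ∃ t t', A.inter t ∈ I ∧ A.inter t' ∈ J ∧ A.inter t ⊓ A.inter t' = X
  · obtain ⟨t, t', ht, ht', hX⟩ := hX
    have hne : X ≠ ⊥ := hX ▸ h.inf_ne_bot _ ht _ ht'
    rw [← inter_append] at hX
    have hlt : ∀ Y, X < Y → affineCodim Y < n := fun Y hY => hn ▸ affineCodim_lt_of_lt hne hY
    have hnil : t ++ t' ≠ [] := fun hnil => htop (by rw [← hX, hnil, inter_nil])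
    rcases hX ▸ h.hasLeastAbove _ hnil (hX ▸ hne) with hleast | hleast
    · exact h.disjoint_joinSpan_ker_of_hasLeastAbove hleast fun Y hY => ih _ (hlt Y hY) h Y rfl
    · exact h.disjoint_joinSpan_ker_of_swap hleast
        (h.symm.disjoint_joinSpan_ker_of_hasLeastAbove hleast fun Y hY =>
          ih _ (hlt Y hY) h.symm Y rfl)
  · have hbot : joinSpan A I J K X = ⊥ := Submodule.span_eq_bot.2 fun y ⟨t, t', ht, ht', htt', _⟩ =>
      absurd ⟨t, t', ht, ht', htt'⟩ hX
    rw [hbot]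
    exact disjoint_bot_left

theorem eq_zero_of_mem_iSup_joinSpan (h : A.IsDecomposition I J)
    (hy : y ∈ ⨆ X, joinSpan A I J K X) (hmul : LinearMap.mul' K _ y = 0) : y = 0 :=
  LinearMap.disjoint_ker.1 (disjoint_iSup_joinSpan_ker_mul' Function.injective_id
    h.disjoint_joinSpan_ker_mul') y hy hmul

end IsDecomposition

end Injectivity

end HyperplaneArrangement

namespace HyperplaneArrangement

variable {F V W U : Type*} [Field F] [AddCommGroup V] [Module F V] [AddCommGroup W] [Module F W]
  [AddCommGroup U] [Module F U]

/-- `B` realizes the ideal `I` of `A`: via `β`, its hyperplanes are those of `A` in `I`, and its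
nonempty intersections are the elements of `I`, with the same codimensions. -/
structure IsRealization (A : HyperplaneArrangement F V) (I : Set (AffineSubspace F V))
    (B : HyperplaneArrangement F W) (β : B.hyperplanes ↪ A.hyperplanes) : Prop where
  exists_of_mem : ∀ H : A.hyperplanes, (H : AffineSubspace F V) ∈ I → ∃ H', β H' = H
  inter_ne_bot_iff : ∀ l, B.inter l ≠ ⊥ ↔ A.inter (l.map β) ∈ I
  affineCodim_inter : ∀ l, B.inter l ≠ ⊥ →
    affineCodim (B.inter l) = affineCodim (A.inter (l.map β))

variable {A : HyperplaneArrangement F V} {B : HyperplaneArrangement F W}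
  {C : HyperplaneArrangement F U} {I J : Set (AffineSubspace F V)}

namespace IsRealization

variable {β : B.hyperplanes ↪ A.hyperplanes}

theorem dependent_iff (h : A.IsRealization I B β) (hI : A.IsFlatIdeal I) {l : List B.hyperplanes}
    (hl : A.inter (l.map β) ∈ I) : B.Dependent l ↔ A.Dependent (l.map β) := by
  have hne : B.inter l ≠ ⊥ := (h.inter_ne_bot_iff l).2 hl
  rw [Dependent, Dependent, h.affineCodim_inter l hne, List.length_map]
  exact and_congr_left fun _ => iff_of_true hne (hI.ne_bot hl)

theorem exists_map_eq (h : A.IsRealization I B β) (hI : A.IsFlatIdeal I)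
    {l : List A.hyperplanes} (hl : A.inter l ∈ I) : ∃ l', List.map β l' = l := by
  change l ∈ Set.range (List.map β)
  rw [Set.range_list_map]
  intro H hH
  refine h.exists_of_mem H ?_
  simpa using hI.inter_mem _ hl [H] (by simpa using A.inter_le_of_mem hH)

theorem osList_eq_zero (h : A.IsRealization I B β) (K : Type*) [CommRing K]
    {l : List B.hyperplanes} (hl : A.inter (l.map β) ∉ I) : osList K B l = 0 :=
  osList_eq_zero_of_inter_eq_bot (not_not.1 fun hne => hl ((h.inter_ne_bot_iff l).1 hne))

section Maps

variable {K : Type*} [CommRing K]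

theorem osProj_extRestrict_of_notMem (h : A.IsRealization I B β) {l : List A.hyperplanes}
    (hl : A.inter l ∉ I) : osProj K B (extRestrict K β (extMonomial K l)) = 0 := by
  by_cases hrange : l ∈ Set.range (List.map β)
  · obtain ⟨l', rfl⟩ := hrange
    rw [extRestrict_extMonomial_map]
    exact h.osList_eq_zero K hl
  · rw [extRestrict_extMonomial_of_notMem K β hrange, map_zero]

theorem osProj_extRestrict_of_dependent (h : A.IsRealization I B β) (hI : A.IsFlatIdeal I)
    {l : List A.hyperplanes} (hl : A.Dependent l) :
    osProj K B (extRestrict K β (extMonomial K l)) = 0 := by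
  by_cases hlI : A.inter l ∈ I
  · obtain ⟨l', rfl⟩ := h.exists_map_eq hI hlI
    rw [extRestrict_extMonomial_map]
    exact osList_eq_zero_of_dependent ((h.dependent_iff hI hlI).2 hl)
  · exact h.osProj_extRestrict_of_notMem hlI

variable [FiniteDimensional F V]

theorem osProj_extRestrict_boundary_of_dependent (h : A.IsRealization I B β)
    (hI : A.IsFlatIdeal I) {l : List A.hyperplanes} (hl : A.Dependent l) :
    osProj K B (extRestrict K β (boundary K A (extMonomial K l))) = 0 := by
  by_cases hlI : A.inter l ∈ I
  · obtain ⟨l', rfl⟩ := h.exists_map_eq hI hlI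
    rw [extRestrict_boundary]
    exact osProj_boundary_of_dependent ((h.dependent_iff hI hlI).2 hl)
  · rw [boundary_extMonomial, map_sum, map_sum]
    refine Finset.sum_eq_zero fun k hk => ?_
    rw [map_smul, map_smul]
    rcases hl.eraseIdx (Finset.mem_range.1 hk) with hdep | heq
    · rw [h.osProj_extRestrict_of_dependent hI hdep, smul_zero]
    · rw [h.osProj_extRestrict_of_notMem (heq ▸ hlI), smul_zero]

variable (K)

/-- The linear map from the Orlik–Solomon algebra of a realization of `I` to that of `A`. Monomials
of `B` with empty intersection must map to zero, hence the projection onto the monomials of `I`. -/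
noncomputable def osInclusion (h : A.IsRealization I B β) (hI : A.IsFlatIdeal I) :
    OrlikSolomon K B →ₗ[K] OrlikSolomon K A :=
  osLift (gradeProj K (· ∈ I) ∘ₗ osProj K A ∘ₗ (extMap K β).toLinearMap)
    (fun l hl => by
      have hlI : A.inter (l.map β) ∉ I := fun hmem => (h.inter_ne_bot_iff l).2 hmem hl
      simp only [LinearMap.comp_apply, AlgHom.toLinearMap_apply, extMap_extMonomial]
      exact (gradeProj_osList _ _).trans (if_neg hlI))
    (fun t l t' hl => by
      have hne : A.inter (l.map β) ∈ I := (h.inter_ne_bot_iff l).1 hl.1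
      simp only [LinearMap.comp_apply, AlgHom.toLinearMap_apply, map_mul, extMap_boundary]
      rw [osProj_mul_boundary_mul_of_dependent ((h.dependent_iff hI hne).1 hl), map_zero])

/-- The linear map from the Orlik–Solomon algebra of `A` to that of a realization of `I` that kills
the monomials outside of `I`. -/
noncomputable def osRestrict (h : A.IsRealization I B β) (hI : A.IsFlatIdeal I) :
    OrlikSolomon K A →ₗ[K] OrlikSolomon K B :=
  osLift (osProj K B ∘ₗ (extRestrict K β).toLinearMap)
    (fun l hl => by
      rw [LinearMap.comp_apply, AlgHom.toLinearMap_apply]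
      exact h.osProj_extRestrict_of_notMem (hl ▸ hI.bot_notMem))
    (fun t l t' hl => by
      simp only [LinearMap.comp_apply, AlgHom.toLinearMap_apply, map_mul, osProj_mul,
        h.osProj_extRestrict_boundary_of_dependent hI hl, mul_zero, zero_mul])

open Classical in
theorem osInclusion_osList (h : A.IsRealization I B β) (hI : A.IsFlatIdeal I)
    (l : List B.hyperplanes) : h.osInclusion K hI (osList K B l) =
      if A.inter (l.map β) ∈ I then osList K A (l.map β) else 0 := by
  rw [osInclusion, osList, osLift_osProj, LinearMap.comp_apply, LinearMap.comp_apply,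
    AlgHom.toLinearMap_apply, extMap_extMonomial, ← osList, gradeProj_osList]

theorem osRestrict_osList_map (h : A.IsRealization I B β) (hI : A.IsFlatIdeal I)
    (l : List B.hyperplanes) : h.osRestrict K hI (osList K A (l.map β)) = osList K B l := by
  rw [osRestrict, osList, osLift_osProj, LinearMap.comp_apply, AlgHom.toLinearMap_apply,
    extRestrict_extMonomial_map, osList]

theorem osRestrict_comp_osInclusion (h : A.IsRealization I B β) (hI : A.IsFlatIdeal I) :
    h.osRestrict K hI ∘ₗ h.osInclusion K hI = LinearMap.id :=
  linearMap_ext_osList fun l => by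
    rw [LinearMap.comp_apply, osInclusion_osList, LinearMap.id_apply]
    split_ifs with hl
    · exact h.osRestrict_osList_map K hI l
    · rw [map_zero, h.osList_eq_zero K hl]

end Maps

end IsRealization

section TensorProduct

variable (K : Type*) [CommRing K]

theorem span_image2_osList_tmul (B : HyperplaneArrangement F W) (C : HyperplaneArrangement F U) :
    Submodule.span K (Set.image2 (· ⊗ₜ[K] ·) (Set.range (osList K B)) (Set.range (osList K C))) =
      ⊤ := by
  rw [← TensorProduct.map₂_mk_top_top_eq_top, ← span_range_osList K B, ← span_range_osList K C,
    Submodule.map₂_span_span]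
  rfl

theorem osTensorDegree_eq_span (B : HyperplaneArrangement F W) (C : HyperplaneArrangement F U)
    (n : ℕ) : osTensorDegree K B C n = Submodule.span K
      {x | ∃ l l', l.length + l'.length = n ∧ x = osList K B l ⊗ₜ[K] osList K C l'} := by
  simp_rw [osTensorDegree, TensorProduct.range_map, Submodule.range_subtype, osDegree_eq_span,
    Submodule.map₂_span_span, ← Submodule.span_iUnion]
  congr 1
  ext x
  simp only [Set.mem_iUnion, Set.mem_image2, Set.mem_image, Set.mem_ofPred_eq]
  grind [TensorProduct.mk_apply]

variable [FiniteDimensional F V] {β : B.hyperplanes ↪ A.hyperplanes}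
  {γ : C.hyperplanes ↪ A.hyperplanes}

namespace IsDecomposition

/-- The map from the tensor product of the Orlik–Solomon algebras of realizations of the two ideals
of a decomposition, given by multiplication in the Orlik–Solomon algebra of `A`. -/
noncomputable def osTensorMul (h : A.IsDecomposition I J) (hB : A.IsRealization I B β)
    (hC : A.IsRealization J C γ) :
    OrlikSolomon K B ⊗[K] OrlikSolomon K C →ₗ[K] OrlikSolomon K A :=
  LinearMap.mul' K _ ∘ₗ TensorProduct.map (hB.osInclusion K h.left) (hC.osInclusion K h.right)

variable (h : A.IsDecomposition I J) (hB : A.IsRealization I B β) (hC : A.IsRealization J C γ)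

open Classical in
theorem osTensorMul_tmul (l : List B.hyperplanes) (l' : List C.hyperplanes) :
    h.osTensorMul K hB hC (osList K B l ⊗ₜ[K] osList K C l') =
      if A.inter (l.map β) ∈ I ∧ A.inter (l'.map γ) ∈ J then
        osList K A (l.map β ++ l'.map γ) else 0 := by
  rw [osTensorMul, LinearMap.comp_apply, TensorProduct.map_tmul, LinearMap.mul'_apply,
    hB.osInclusion_osList K, hC.osInclusion_osList K, ite_zero_mul_ite_zero, osList_append]

theorem range_map_osInclusion_le_iSup_joinSpan :
    LinearMap.range (TensorProduct.map (hB.osInclusion K h.left) (hC.osInclusion K h.right)) ≤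
      ⨆ X, joinSpan A I J K X := by
  rw [← Submodule.map_top, ← span_image2_osList_tmul, Submodule.map_span_le]
  rintro _ ⟨_, ⟨l, rfl⟩, _, ⟨l', rfl⟩, rfl⟩
  rw [TensorProduct.map_tmul, hB.osInclusion_osList K, hC.osInclusion_osList K]
  split_ifs with hl hl'
  · exact Submodule.mem_iSup_of_mem _ (Submodule.subset_span ⟨_, _, hl, hl', rfl, rfl⟩)
  all_goals simp

theorem osTensorMul_injective : Function.Injective (h.osTensorMul K hB hC) := by
  refine (injective_iff_map_eq_zero _).2 fun y hy => ?_
  have hzero := h.eq_zero_of_mem_iSup_joinSpan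
    (h.range_map_osInclusion_le_iSup_joinSpan K hB hC (LinearMap.mem_range_self _ y)) hy
  have hcomp :=
    congrArg (TensorProduct.map (hB.osRestrict K h.left) (hC.osRestrict K h.right)) hzero
  rwa [map_zero, ← LinearMap.comp_apply, ← TensorProduct.map_comp,
    hB.osRestrict_comp_osInclusion K, hC.osRestrict_comp_osInclusion K,
    TensorProduct.map_id] at hcomp

theorem productSpan_le_map_osTensorMul (n : ℕ) (X : AffineSubspace F V) :
    productSpan A I J K n X ≤ (osTensorDegree K B C n).map (h.osTensorMul K hB hC) := by
  refine Submodule.span_le.2 ?_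
  rintro _ ⟨t, t', ht, ht', hlen, -, -, rfl⟩
  obtain ⟨l, rfl⟩ := hB.exists_map_eq h.left ht
  obtain ⟨l', rfl⟩ := hC.exists_map_eq h.right ht'
  refine ⟨osList K B l ⊗ₜ osList K C l', ?_, ?_⟩
  · rw [SetLike.mem_coe, osTensorDegree_eq_span]
    exact Submodule.subset_span ⟨l, l', by simpa using hlen, rfl⟩
  · rw [h.osTensorMul_tmul K, if_pos ⟨ht, ht'⟩, osList_append]

theorem map_osTensorMul_osTensorDegree (n : ℕ) :
    (osTensorDegree K B C n).map (h.osTensorMul K hB hC) = osDegree K A n := by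
  apply le_antisymm
  · rw [osTensorDegree_eq_span, Submodule.map_span_le, osDegree_eq_span]
    rintro _ ⟨l, l', rfl, rfl⟩
    rw [h.osTensorMul_tmul K]
    split_ifs
    · exact Submodule.subset_span ⟨_, by simp, rfl⟩
    · exact zero_mem _
  · rw [osDegree_eq_span, Submodule.span_le]
    rintro _ ⟨l, rfl, rfl⟩
    exact h.productSpan_le_map_osTensorMul K hB hC _ _ (h.osList_mem_productSpan l)

theorem osTensorMul_surjective : Function.Surjective (h.osTensorMul K hB hC) := by
  rw [← LinearMap.range_eq_top, eq_top_iff, ← span_range_osList K A, Submodule.span_le]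
  rintro _ ⟨l, rfl⟩
  exact LinearMap.map_le_range
    (h.productSpan_le_map_osTensorMul K hB hC _ _ (h.osList_mem_productSpan l))

theorem exists_linearEquiv_of_isRealization (h : A.IsDecomposition I J)
    (hB : A.IsRealization I B β) (hC : A.IsRealization J C γ) :
    ∃ Φ : A.OrlikSolomon K ≃ₗ[K] B.OrlikSolomon K ⊗[K] C.OrlikSolomon K,
      ∀ p : ℕ, (A.osDegree K p).map (Φ : A.OrlikSolomon K →ₗ[K] _) = osTensorDegree K B C p := by
  let Ψ := LinearEquiv.ofBijective (h.osTensorMul K hB hC)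
    ⟨h.osTensorMul_injective K hB hC, h.osTensorMul_surjective K hB hC⟩
  refine ⟨Ψ.symm, fun p => ?_⟩
  have hmap : (osTensorDegree K B C p).map (Ψ : _ →ₗ[K] A.OrlikSolomon K) = osDegree K A p :=
    h.map_osTensorMul_osTensorDegree K hB hC p
  rw [← hmap, ← Submodule.map_comp, LinearEquiv.symm_comp, Submodule.map_id]

end IsDecomposition

end TensorProduct

end HyperplaneArrangement

namespace HyperplaneArrangement

variable {F V W : Type*} [Field F] [AddCommGroup V] [Module F V] [AddCommGroup W] [Module F W]
  {A : HyperplaneArrangement F V} {I J : Set (AffineSubspace F V)}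

section Slice

variable (A I) in
/-- The image of `f` is an affine subspace on which the hyperplanes of `A` in `I` cut out an
arrangement whose nonempty intersections are exactly the elements of `I`. -/
structure IsSlice (f : W →ᵃ[F] V) : Prop where
  direction_sup_range : ∀ X ∈ I, X.direction ⊔ LinearMap.range f.linear = ⊤
  inter_mem : ∀ l : List A.hyperplanes, (∀ H ∈ l, (H : AffineSubspace F V) ∈ I) →
    (A.inter l).comap f ≠ ⊥ → A.inter l ∈ I

theorem IsFlatIdeal.inter_mem_of_isLeast (hI : A.IsFlatIdeal I) {X Z : AffineSubspace F V}
    (hZ : IsLeast {W ∈ I | X ≤ W} Z) {l : List A.hyperplanes}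
    (hl : ∀ H ∈ l, (H : AffineSubspace F V) ∈ I) (hX : X ≤ A.inter l) : A.inter l ∈ I :=
  hI.inter_mem Z hZ.1.1 l (A.le_inter_iff.2 fun H hH =>
    hZ.2 ⟨hl H hH, hX.trans (A.inter_le_of_mem hH)⟩)

namespace IsDecomposition

variable [FiniteDimensional F V]

theorem direction_sup_direction_ne_top (h : A.IsDecomposition I J) {Y : AffineSubspace F V}
    (hY : Y ∈ J) (hmax : ∀ Z ∈ J, affineCodim Z ≤ affineCodim Y) {l : List A.hyperplanes}
    (hl : ∀ H ∈ l, (H : AffineSubspace F V) ∈ I) (hne : A.inter l ≠ ⊥) (hnot : A.inter l ∉ I) :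
    (A.inter l).direction ⊔ Y.direction ≠ ⊤ := by
  intro htop
  have hnil : l ≠ [] := by
    rintro rfl
    exact hnot (A.inter_nil ▸ h.left.top_mem)
  obtain ⟨Z, hZtop, hZ⟩ : HasLeastAbove J (A.inter l) := (h.hasLeastAbove l hnil hne).resolve_left
    fun ⟨_, _, hZ⟩ => hnot (h.left.inter_mem_of_isLeast hZ hl le_rfl)
  obtain ⟨r, rfl⟩ := h.right.exists_inter Y hY
  have hjoin := inf_ne_bot_of_direction_sup_eq_top hne (h.right.ne_bot hY) htop
  rw [← inter_append] at hjoin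
  obtain ⟨Z', -, hZ'⟩ : HasLeastAbove J (A.inter (l ++ r)) :=
    (h.hasLeastAbove (l ++ r) (by simp [hnil]) hjoin).resolve_left fun ⟨_, _, hZ'⟩ =>
      hnot (h.left.inter_mem_of_isLeast hZ' hl (inter_append A l r ▸ inf_le_left))
  rw [inter_append] at hZ'
  obtain rfl : Z' = A.inter r := eq_of_le_of_affineCodim_le (h.right.ne_bot hZ'.1.1)
    (hZ'.2 ⟨hY, inf_le_right⟩) (hmax _ hZ'.1.1)
  have hrZ : A.inter r ≤ Z := hZ'.2 ⟨hZ.1.1, inf_le_left.trans hZ.1.2⟩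
  have hZdir := sup_le (AffineSubspace.direction_le hZ.1.2) (AffineSubspace.direction_le hrZ)
  rw [htop, top_le_iff, AffineSubspace.direction_eq_top_iff_of_nonempty
    ((AffineSubspace.nonempty_iff_ne_bot Z).2 (h.right.ne_bot hZ.1.1))] at hZdir
  exact hZtop hZdir

/-- The slice is a generic translate of an element of `J` of maximal codimension: genericity makes
it miss the intersections that are not transversal to it. -/
theorem exists_isSlice [Infinite F] (h : A.IsDecomposition I J) :
    ∃ (m : ℕ) (f : (Fin m → F) →ᵃ[F] V), A.IsSlice I f := by
  have hfin : J.Finite := A.finite_range_inter.subset fun X hX =>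
    (h.right.exists_inter X hX).imp fun _ => Eq.symm
  obtain ⟨Y, hY, hmax⟩ := Set.exists_max_image J affineCodim hfin ⟨⊤, h.right.top_mem⟩
  obtain ⟨v, hv⟩ := exists_forall_sub_notMem_of_sup_ne_top A.finite_range_inter Y.direction
  obtain ⟨m, f, hf, hfv⟩ := exists_affineMap_range_linear_eq Y.direction v
  refine ⟨m, f, fun X hX => ?_, fun l hl hne => ?_⟩
  · rw [hf, direction_sup_eq_top_iff (h.inf_ne_bot X hX Y hY)]
    exact h.affineCodim_inf X hX Y hY
  · by_contra hnot
    have hbot : A.inter l ≠ ⊥ := fun h0 => hne (by rw [h0, AffineSubspace.comap_bot])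
    obtain ⟨w, hw⟩ := (AffineSubspace.nonempty_iff_ne_bot _).2 hne
    exact hv (A.inter l) ⟨l, rfl⟩ (h.direction_sup_direction_ne_top hY hmax hl hbot hnot) (f w)
      (AffineSubspace.mem_comap.1 hw) (hfv w)

end IsDecomposition

namespace IsSlice

variable {f : W →ᵃ[F] V}

theorem comap_ne_bot (h : A.IsSlice I f) (hI : A.IsFlatIdeal I) {X : AffineSubspace F V}
    (hX : X ∈ I) : X.comap f ≠ ⊥ :=
  comap_ne_bot_of_direction_sup_range_eq_top (hI.ne_bot hX) (h.direction_sup_range X hX)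

theorem affineCodim_comap (h : A.IsSlice I f) (hI : A.IsFlatIdeal I) {X : AffineSubspace F V}
    (hX : X ∈ I) : affineCodim (X.comap f) = affineCodim X :=
  _root_.affineCodim_comap (hI.ne_bot hX) (h.direction_sup_range X hX)

theorem eq_of_comap_eq [FiniteDimensional F V] (h : A.IsSlice I f) (hI : A.IsFlatIdeal I)
    {H H' : A.hyperplanes} (hH : (H : AffineSubspace F V) ∈ I)
    (hH' : (H' : AffineSubspace F V) ∈ I)
    (hcomap : (H : AffineSubspace F V).comap f = (H' : AffineSubspace F V).comap f) : H = H' := by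
  have hinter : A.inter [H, H'] = H.1 ⊓ H'.1 := by simp
  have hcomap_inter : (H.1 ⊓ H'.1).comap f = H.1.comap f := by
    rw [AffineSubspace.comap_inf, ← hcomap, inf_idem]
  have hmem : H.1 ⊓ H'.1 ∈ I := hinter ▸ h.inter_mem [H, H'] (by simp [hH, hH'])
    (by rw [hinter, hcomap_inter]; exact h.comap_ne_bot hI hH)
  have hcodim : affineCodim (H.1 ⊓ H'.1) = 1 := by
    rw [← h.affineCodim_comap hI hmem, hcomap_inter, h.affineCodim_comap hI hH,
      A.codim_of_mem _ H.2]
  have heq : ∀ G : A.hyperplanes, H.1 ⊓ H'.1 ≤ G → H.1 ⊓ H'.1 = G := fun G hG =>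
    eq_of_le_of_affineCodim_le (hI.ne_bot hmem) hG (by rw [hcodim, A.codim_of_mem _ G.2])
  exact Subtype.ext ((heq H inf_le_left).symm.trans (heq H' inf_le_right))

open Classical in
/-- The arrangement cut out on a slice for `I` by the hyperplanes in `I`. -/
noncomputable def pullback (h : A.IsSlice I f) (hI : A.IsFlatIdeal I) :
    HyperplaneArrangement F W where
  hyperplanes := (A.hyperplanes.filter (· ∈ I)).image (AffineSubspace.comap f)
  ne_bot_of_mem := by
    simp only [Finset.forall_mem_image, Finset.mem_filter]
    exact fun H hH => h.comap_ne_bot hI hH.2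
  codim_of_mem := by
    simp only [Finset.forall_mem_image, Finset.mem_filter]
    exact fun H hH => (h.affineCodim_comap hI hH.2).trans (A.codim_of_mem H hH.1)

theorem mem_pullback_iff (h : A.IsSlice I f) (hI : A.IsFlatIdeal I) {H : AffineSubspace F W} :
    H ∈ (h.pullback hI).hyperplanes ↔
      ∃ G : A.hyperplanes, (G : AffineSubspace F V) ∈ I ∧ G.1.comap f = H := by
  simp [pullback, and_assoc, and_left_comm]

theorem exists_isRealization_pullback [FiniteDimensional F V] (h : A.IsSlice I f)
    (hI : A.IsFlatIdeal I) : ∃ β, A.IsRealization I (h.pullback hI) β := by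
  choose β hβI hβ using fun H : (h.pullback hI).hyperplanes => (h.mem_pullback_iff hI).1 H.2
  have hinj : Function.Injective β := fun H H' heq => Subtype.ext (by rw [← hβ H, ← hβ H', heq])
  have hinter : ∀ l, (h.pullback hI).inter l = (A.inter (l.map β)).comap f := fun l => by
    induction l with
    | nil => simp
    | cons H l ih => rw [List.map_cons, inter_cons, inter_cons, ih, AffineSubspace.comap_inf, hβ]
  have hbot : ∀ l, (h.pullback hI).inter l ≠ ⊥ ↔ A.inter (l.map β) ∈ I := fun l => by
    rw [hinter]
    exact ⟨h.inter_mem _ (List.forall_mem_map.2 fun H _ => hβI H), h.comap_ne_bot hI⟩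
  refine ⟨⟨β, hinj⟩, fun H hH => ?_, hbot, fun l hl => ?_⟩
  · let H' : (h.pullback hI).hyperplanes := ⟨H.1.comap f, (h.mem_pullback_iff hI).2 ⟨H, hH, rfl⟩⟩
    exact ⟨H', h.eq_of_comap_eq hI (hβI H') hH (hβ H')⟩
  · rw [hinter]
    exact h.affineCodim_comap hI ((hbot l).1 hl)

end IsSlice

theorem IsDecomposition.exists_isRealization [FiniteDimensional F V] [Infinite F]
    (h : A.IsDecomposition I J) :
    ∃ (m : ℕ) (B : HyperplaneArrangement F (Fin m → F)) (β : B.hyperplanes ↪ A.hyperplanes),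
      A.IsRealization I B β := by
  obtain ⟨m, f, hf⟩ := h.exists_isSlice
  exact ⟨m, hf.pullback h.left, hf.exists_isRealization_pullback h.left⟩

end Slice

namespace IsRealization

variable [FiniteDimensional F V] [FiniteDimensional F W] {B : HyperplaneArrangement F W}
  {β : B.hyperplanes ↪ A.hyperplanes} {l l' : List B.hyperplanes}

theorem inter_le_inter_iff (h : A.IsRealization I B β) (hI : A.IsFlatIdeal I)
    (hl : B.inter l ≠ ⊥) :
    B.inter l ≤ B.inter l' ↔ A.inter (l.map β) ≤ A.inter (l'.map β) := by
  have happend : A.inter ((l ++ l').map β) = A.inter (l.map β) ⊓ A.inter (l'.map β) := by simp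
  have hcodim := h.affineCodim_inter l hl
  rw [← inf_eq_left, ← inf_eq_left, ← happend, ← inter_append]
  constructor
  · intro heq
    have hne : B.inter (l ++ l') ≠ ⊥ := heq ▸ hl
    rw [← heq, h.affineCodim_inter _ hne] at hcodim
    exact eq_of_le_of_affineCodim_le (hI.ne_bot ((h.inter_ne_bot_iff _).1 hne))
      (happend ▸ inf_le_left) hcodim.le
  · intro heq
    have hne : B.inter (l ++ l') ≠ ⊥ := (h.inter_ne_bot_iff _).2 (heq ▸ (h.inter_ne_bot_iff l).1 hl)
    rw [← heq, ← h.affineCodim_inter _ hne] at hcodim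
    exact eq_of_le_of_affineCodim_le hne (inter_append B l l' ▸ inf_le_left) hcodim.ge

theorem nonempty_orderIso {S : Set A.L} (h : A.IsRealization (L.space '' S) B β)
    (hS : A.IsFlatIdeal (L.space '' S)) : Nonempty (B.L ≃o S) := by
  choose r hr using fun X : B.L => ((B.mem_flats_iff X.space).1 X.2).2
  have hne : ∀ X : B.L, B.inter (r X) ≠ ⊥ := fun X => hr X ▸ X.2.1
  choose g hgS hg using fun X : B.L => (h.inter_ne_bot_iff (r X)).1 (hne X)
  refine ⟨RelIso.ofSurjective (OrderEmbedding.ofMapLEIff (fun X => (⟨g X, hgS X⟩ : S)) ?_) ?_⟩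
  · intro X Y
    change (g Y).space ≤ (g X).space ↔ Y.space ≤ X.space
    rw [hg, hg, hr X, hr Y]
    exact (h.inter_le_inter_iff hS (hne Y)).symm
  · rintro ⟨X, hX⟩
    obtain ⟨l, hl⟩ := hS.exists_inter _ ⟨X, hX, rfl⟩
    have hlS : A.inter l ∈ L.space '' S := ⟨X, hX, hl⟩
    obtain ⟨l', rfl⟩ := h.exists_map_eq hS hlS
    have hl' : B.inter l' ≠ ⊥ := (h.inter_ne_bot_iff l').2 hlS
    let Y : B.L := ⟨OrderDual.toDual (B.inter l'), (B.mem_flats_iff _).2 ⟨hl', l', rfl⟩⟩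
    have hY : B.inter (r Y) = B.inter l' := (hr Y).symm
    refine ⟨Y, Subtype.ext (Subtype.ext ?_)⟩
    change (g Y).space = X.space
    rw [hg, hl]
    exact le_antisymm ((h.inter_le_inter_iff hS (hne Y)).1 hY.le)
      ((h.inter_le_inter_iff hS hl').1 hY.ge)

end IsRealization

section ModularIdeal

theorem IsIdeal.isFlatIdeal {S : Set A.L} (hS : IsIdeal S) : A.IsFlatIdeal (L.space '' S) where
  bot_notMem := fun ⟨X, _, hX⟩ => X.2.1 hX
  top_mem := ⟨⊥, hS.2 bot_le hS.1.some_mem, rfl⟩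
  exists_inter := by
    rintro _ ⟨X, -, rfl⟩
    exact ((A.mem_flats_iff X.space).1 X.2).2
  inter_mem := by
    rintro _ ⟨X, hX, rfl⟩ l hl
    have hne : A.inter l ≠ ⊥ := ne_bot_of_le_ne_bot X.2.1 hl
    exact ⟨⟨OrderDual.toDual (A.inter l), (A.mem_flats_iff _).2 ⟨hne, l, rfl⟩⟩, hS.2 hl hX, rfl⟩

theorem hasLeastAbove_of_inter_Iic_eq {S : Set A.L} {X Z : A.L} (hZ : Z ≠ ⊥)
    (hS : S ∩ Set.Iic X = Set.Iic Z) : HasLeastAbove (L.space '' S) X.space := by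
  have hmem : Z ∈ S ∩ Set.Iic X := hS ▸ Set.self_mem_Iic
  refine ⟨Z.space, fun htop => hZ (Subtype.ext htop), ⟨⟨Z, hmem.1, rfl⟩, hmem.2⟩, ?_⟩
  rintro _ ⟨⟨Y, hY, rfl⟩, hXY⟩
  exact (L.le_iff Y Z).1 (hS.le ⟨hY, hXY⟩)

theorem IsIdealDecomposition.isDecomposition {S T : Set A.L} (h : IsIdealDecomposition ![S, T]) :
    A.IsDecomposition (L.space '' S) (L.space '' T) := by
  have hpair : ∀ X ∈ S, ∀ Y ∈ T, ∀ i, ![X, Y] i ∈ ![S, T] i := fun X hX Y hY =>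
    Fin.forall_fin_two.2 ⟨hX, hY⟩
  have hinf : ∀ X Y : A.L, ⨅ i, (![X, Y] i).space = X.space ⊓ Y.space := fun X Y => by
    rw [← Finset.inf_univ_eq_iInf]
    simp [Fin.univ_succ]
  refine ⟨(h.isIdeal 0).isFlatIdeal, (h.isIdeal 1).isFlatIdeal, fun l hl hne => ?_, ?_, ?_⟩
  · let X : A.L := ⟨OrderDual.toDual (A.inter l), (A.mem_flats_iff _).2 ⟨hne, l, rfl⟩⟩
    have hX : X ≠ ⊥ := fun hbot => hl (A.inter_eq_top_iff.1 (congrArg L.space hbot))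
    obtain ⟨j, Z, hZ, hj⟩ := h.meet_condition X hX
    fin_cases j
    · exact Or.inl (hasLeastAbove_of_inter_Iic_eq hZ hj)
    · exact Or.inr (hasLeastAbove_of_inter_Iic_eq hZ hj)
  · rintro _ ⟨X, hX, rfl⟩ _ ⟨Y, hY, rfl⟩
    rw [← hinf]
    exact h.join_condition _ (hpair X hX Y hY)
  · rintro _ ⟨X, hX, rfl⟩ _ ⟨Y, hY, rfl⟩
    rw [← hinf, h.rank_condition _ (hpair X hX Y hY), Fin.sum_univ_two]
    rfl

end ModularIdeal

end HyperplaneArrangement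

theorem mainTheorem8 {F V : Type*} [Field F] [Infinite F] [AddCommGroup V] [Module F V]
    [FiniteDimensional F V] (K : Type*) [CommRing K]
    (A : HyperplaneArrangement F V) (I : Set A.L)
    (hI : HyperplaneArrangement.IsModularIdeal I) :
    ∃ (m n : ℕ) (B : HyperplaneArrangement F (Fin m → F)) (C : HyperplaneArrangement F (Fin n → F)),
      Nonempty (B.L ≃o I) ∧
      Nonempty (C.L ≃o HyperplaneArrangement.meetCompl I) ∧
      ∃ Φ : A.OrlikSolomon K ≃ₗ[K] B.OrlikSolomon K ⊗[K] C.OrlikSolomon K,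
        ∀ p : ℕ, (A.osDegree K p).map (Φ : A.OrlikSolomon K →ₗ[K] _) =
          HyperplaneArrangement.osTensorDegree K B C p := by
  have h := HyperplaneArrangement.IsIdealDecomposition.isDecomposition hI
  obtain ⟨m, B, β, hB⟩ := h.exists_isRealization
  obtain ⟨n, C, γ, hC⟩ := h.symm.exists_isRealization
  exact ⟨m, n, B, C, hB.nonempty_orderIso h.left, hC.nonempty_orderIso h.right,
    h.exists_linearEquiv_of_isRealization K hB hC⟩
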